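/- All graphs are finite and simple, and $\Delta(G)$ denotes the maximum degree of $G$. A \emph{$k$-net} in $G$ is a cycle of length $k$ that has at least one chord in $G$. Let $H$ be a graph with an orientation. For an Abelian group $A$, an assignment $L$ of a list $L(x)\subseteq A$ to each vertex $x$, and a function $f:E(H)\to A$, an \emph{$(A,L,f)$-coloring} is a map $c:V(H)\to A$ such that $c(x)\in L(x)$ for every vertex $x$ and $c(x)-c(y)\neq f(e)$ for every edge $e=xy$ directed from $x$ to $y$. The graph $H$ is \emph{$k$-group choosable} if, for every Abelian group $A$ (finite or infinite) of order at least $k$, every assignment $L$ of lists with $|L(x)|=k$ for all $x$, and every $f:E(H)\to A$, an $(A,L,f)$-coloring exists. (This does not depend on the orientation.) The \emph{group-choice index} $\chi'_{gl}(G)$ is the least $k$ such that the line graph of $G$ is $k$-group choosable. **Theorem.** Let $G$ be a planar graph (that is, each connected component of $G$ has a combinatorial embedding of genus $0$) without $5$-nets. 1. If $\Delta(G)\geq 6$, then $\chi'_{gl}(G)\leq\max\{8,\Delta(G)+1\}$. 2. If $\Delta(G)=5$ and $G$ contains no $4$-nets or $G$ contains no $6$-nets, then $\chi'_{gl}(G)\leq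 7$. -/

import Mathlib

universe u v

namespace SimpleGraph

variable {V : Type v}

/-! ### Planar graphs, through combinatorial embeddings -/

/-- A rotation system (combinatorial embedding) of `G`: for every vertex, a cyclic order of the
darts (oriented edges) leaving it. `next d` is the dart that follows `d` around `d.fst`. -/
structure RotationSystem (G : SimpleGraph V) where
  next : Equiv.Perm G.Dart
  fst_next : ∀ d, (next d).fst = d.fst
  sameCycle : ∀ d d', d.fst = d'.fst → next.SameCycle d d'

namespace RotationSystem

variable {G : SimpleGraph V}

/-- The face-tracing permutation: traverse the dart `d`, then leave its end vertex along the dart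
that follows the reversal of `d` in the rotation there. -/
def faceStep (R : G.RotationSystem) : Equiv.Perm G.Dart :=
  (Dart.symm_involutive.toPerm : Equiv.Perm G.Dart).trans R.next

/-- The faces of the cellular embedding, component by component: the facial walks (the cycles of
`faceStep`) and, for every isolated vertex, the one face of the sphere carrying that vertex. -/
def Face (R : G.RotationSystem) : Type v :=
  Quotient (Equiv.Perm.SameCycle.setoid R.faceStep) ⊕ {v : V // ∀ w, ¬ G.Adj v w}

/-- The rotation system describes an embedding of each connected component in the sphere.
A component with `n` vertices, `m` edges and `f` faces is embedded in an orientable surface of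
genus `g`, where `n - m + f = 2 - 2 * g`; summed over all components, every genus is `0` exactly if
the total of `n - m + f` is twice the number of components. -/
def IsSpherical (R : G.RotationSystem) : Prop :=
  Nat.card V + Nat.card R.Face = Nat.card G.edgeSet + 2 * Nat.card G.ConnectedComponent

end RotationSystem

/-- A finite graph is planar if it has a combinatorial embedding of genus zero. -/
def IsPlanar [Finite V] (G : SimpleGraph V) : Prop :=
  ∃ R : G.RotationSystem, R.IsSpherical

/-! ### Nets -/

/-- `G` contains a `k`-net: a cycle of length `k` with at least one chord in `G`. -/
def HasNet (G : SimpleGraph V) (k : ℕ) : Prop :=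
  ∃ (x : V) (c : G.Walk x x), c.IsCycle ∧ c.length = k ∧ ∃ e, c.IsChord e

/-! ### Group choosability -/

/-- An orientation of `G`: every edge is directed, from `(dart e).fst` to `(dart e).snd`. -/
structure Orientation (G : SimpleGraph V) where
  dart : G.edgeSet → G.Dart
  edge_dart : ∀ e, (dart e).edge = e

/-- `c` is an `(A, L, f)`-coloring of `G` under the orientation `D`: all colors come from the lists,
and `c x - c y ≠ f e` for every edge `e` directed from `x` to `y`. -/
def IsGroupListColoring {A : Type u} [AddCommGroup A] (G : SimpleGraph V) (D : G.Orientation)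
    (L : V → Finset A) (f : G.edgeSet → A) (c : V → A) : Prop :=
  (∀ x, c x ∈ L x) ∧ ∀ e : G.edgeSet, c (D.dart e).fst - c (D.dart e).snd ≠ f e

/-- `G` is `k`-group choosable: for every Abelian group `A` (finite or infinite) of order at least
`k` and all lists of `k` elements of `A`, each `f` admits an `(A, L, f)`-coloring. -/
def GroupChoosable (G : SimpleGraph V) (k : ℕ) : Prop :=
  ∀ (A : Type u) [AddCommGroup A], (k : ℕ∞) ≤ ENat.card A →
    ∀ L : V → Finset A, (∀ x, (L x).card = k) →
      ∀ (D : G.Orientation) (f : G.edgeSet → A), ∃ c : V → A, G.IsGroupListColoring D L f c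

/-- The group choice number: the least `k` such that `G` is `k`-group choosable (`⊤` if there is
none, which does not happen for finite graphs). -/
noncomputable def groupChoiceNumber (G : SimpleGraph V) : ℕ∞ :=
  ⨅ k ∈ {k : ℕ | GroupChoosable.{u} G k}, (k : ℕ∞)

/-- The group-choice index: the group choice number of the line graph. -/
noncomputable def groupChoiceIndex (G : SimpleGraph V) : ℕ∞ :=
  groupChoiceNumber.{u} G.lineGraph

end SimpleGraph

/-! The colouring is greedy. An edge uv of a subgraph with d(u) + d(v) ≤ k + 1 meets at most k - 1
other edges, and each of these, once coloured, forbids one colour. So the line graph is k-group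
choosable as soon as every nonempty subgraph has such a light edge
(`IsPlanar.groupChoosable_lineGraph`). For the k in question, a subgraph without light edges has
minimum degree at least 3, its 3-vertices have only neighbours of degree at least 7, and its
4-vertices only neighbours of degree at least 5 (`NoLightDart`).

Discharging excludes this (`not_noLightDart`). A vertex starts with its degree minus 4, a face with
its length minus 4; by Euler's formula the total is negative. A vertex of degree at least 5 gives
3/10 to each triangle at it; a 3-vertex takes 1/3 from each neighbour; each neighbour of a wheel
centre gives it 1/5, which the centre passes on to one of its three triangles; a non-triangular face
gives 1/5 across each edge to a triangle. Afterwards neither vertices nor faces have negative total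
charge. The absence of 5-nets enters twice: a triangular face shares no edge with a quadrangular
one, and three consecutive triangular corners occur only at degree 3.

All subgraphs live on the darts of the whole graph. Deleting an edge turns its two darts into fixed
points of the rotation, so the edge becomes a component of its own; this preserves Euler's
inequality (`Equiv.Perm.EulerBound.swap_mul`). -/

section

open Equiv.Perm

/-! ### Cycle counts of permutations and Euler's inequality -/

section Permutations

variable {D : Type v}

theorem Setoid.card_quotient_le [Finite D] {r s : Setoid D} (h : r ≤ s) :
    Nat.card (Quotient s) ≤ Nat.card (Quotient r) :=
  Nat.card_le_card_of_surjective (Quotient.map' id fun _ _ hxy => h hxy) fun q =>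
    Quotient.inductionOn q fun x => ⟨Quotient.mk r x, rfl⟩

theorem Setoid.card_quotient_lt [Finite D] {r s : Setoid D} (h : r ≤ s) {x y : D}
    (hr : ¬ r x y) (hs : s x y) : Nat.card (Quotient s) < Nat.card (Quotient r) := by
  refine lt_of_le_of_ne (Setoid.card_quotient_le h) fun hcard => hr ?_
  let g : Quotient r → Quotient s := Quotient.map' id fun _ _ hxy => h hxy
  have hg : Function.Surjective g := fun q =>
    Quotient.inductionOn q fun x => ⟨Quotient.mk r x, rfl⟩
  have hinj : Function.Injective g :=
    ((Nat.bijective_iff_surjective_and_card g).2 ⟨hg, hcard.symm⟩).1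
  exact Quotient.exact (hinj (a₁ := Quotient.mk r x) (a₂ := Quotient.mk r y) (Quotient.sound hs))

/-- Identifying two points lowers the number of classes by at most one. -/
theorem Setoid.card_quotient_le_add_one [Finite D] {r s : Setoid D} (x y : D)
    (h : ∀ t : Setoid D, r ≤ t → t x y → s ≤ t) :
    Nat.card (Quotient r) ≤ Nat.card (Quotient s) + 1 := by
  classical
  -- `g` merges the class of `y` into that of `x`. Its kernel `t` lies above `r` and relates `x` to
  -- `y`; its values miss at most the class of `y`.
  let g : Quotient r → Quotient r := fun q => if q = Quotient.mk r y then Quotient.mk r x else q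
  let t : Setoid D := Setoid.ker fun d => g (Quotient.mk r d)
  have hst : s ≤ t := by
    refine h t (fun a b hab => ?_) ?_
    · exact congrArg g (Quotient.sound hab)
    · change g _ = g _
      simp only [g, if_true]
      split_ifs <;> rfl
  have hcard := Setoid.card_quotient_le hst
  refine le_trans ?_ (Nat.add_le_add_right hcard 1)
  have : Fintype (Quotient r) := Fintype.ofFinite _
  let k : Quotient t → Quotient r := Quotient.lift (fun d => g (Quotient.mk r d)) fun a b hab => hab
  have hsub : (Set.univ : Set (Quotient r)) ⊆ insert (Quotient.mk r y) (Set.range k) := by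
    intro q _
    by_cases hq : q = Quotient.mk r y
    · exact Or.inl hq
    · obtain ⟨d, rfl⟩ := Quotient.exists_rep q
      exact Or.inr ⟨Quotient.mk t d, by simp [k, g, hq]⟩
  calc Nat.card (Quotient r) = (Set.univ : Set (Quotient r)).ncard := (Set.ncard_univ _).symm
    _ ≤ (insert (Quotient.mk r y) (Set.range k)).ncard := Set.ncard_le_ncard hsub
    _ ≤ (Set.range k).ncard + 1 := Set.ncard_insert_le _ _
    _ ≤ Nat.card (Quotient t) + 1 := by
        gcongr
        rw [← Set.image_univ, ← Set.ncard_univ]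
        exact Set.ncard_image_le

theorem Equiv.Perm.sameCycle_setoid_le {π : Equiv.Perm D} {s : Setoid D} (h : ∀ x, s x (π x)) :
    SameCycle.setoid π ≤ s := by
  rintro x y ⟨i, rfl⟩
  induction i with
  | zero => exact s.refl _
  | succ n ih =>
    refine s.trans ih ?_
    rw [add_comm, zpow_add, zpow_one, Equiv.Perm.mul_apply]
    exact h _
  | pred n ih =>
    refine s.trans ih (s.symm ?_)
    have := h ((π ^ (-(n : ℤ) - 1)) x)
    rwa [← Equiv.Perm.mul_apply, ← zpow_one_add, add_sub_cancel] at this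

/-- The number of cycles of a permutation, fixed points included. -/
noncomputable def Equiv.Perm.numCycles (π : Equiv.Perm D) : ℕ :=
  Nat.card (Quotient (SameCycle.setoid π))

theorem Equiv.Perm.sameCycle_apply_self (π : Equiv.Perm D) (x : D) : SameCycle.setoid π x (π x) :=
  ⟨1, by simp⟩

theorem Setoid.rel_swap_apply [DecidableEq D] {s : Setoid D} {x y : D} (h : s x y) (z : D) :
    s z (Equiv.swap x y z) := by
  rw [Equiv.swap_apply_def]
  split_ifs with h1 h2
  · exact h1 ▸ h
  · exact h2 ▸ s.symm h
  · exact s.refl _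

theorem Equiv.Perm.sameCycle_swap_mul_le [DecidableEq D] {π : Equiv.Perm D} {x y : D}
    {t : Setoid D} (ht : SameCycle.setoid π ≤ t) (hxy : t x y) :
    SameCycle.setoid (Equiv.swap x y * π) ≤ t :=
  sameCycle_setoid_le fun z =>
    t.trans (ht (sameCycle_apply_self π z)) (Setoid.rel_swap_apply hxy (π z))

theorem Equiv.Perm.le_sameCycle_swap_mul [DecidableEq D] {π : Equiv.Perm D} {x y : D}
    {t : Setoid D} (ht : SameCycle.setoid (Equiv.swap x y * π) ≤ t) (hxy : t x y) :
    SameCycle.setoid π ≤ t := by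
  have := sameCycle_swap_mul_le ht hxy
  rwa [Equiv.swap_mul_self_mul] at this

theorem Equiv.Perm.numCycles_le_swap_mul_add_one [Finite D] [DecidableEq D] (π : Equiv.Perm D)
    (x y : D) : π.numCycles ≤ (Equiv.swap x y * π).numCycles + 1 :=
  Setoid.card_quotient_le_add_one x y fun _ => sameCycle_swap_mul_le

theorem Equiv.Perm.numCycles_lt_swap_mul [Finite D] [DecidableEq D] {π : Equiv.Perm D} {x y : D}
    (h : π.SameCycle x y) (h' : ¬ (Equiv.swap x y * π).SameCycle x y) :
    π.numCycles < (Equiv.swap x y * π).numCycles :=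
  Setoid.card_quotient_lt (sameCycle_swap_mul_le le_rfl h) h' h

/-- A point that returns to itself without meeting `y` is not in the cycle of `y`. -/
theorem Equiv.Perm.not_sameCycle_of_pow_eq {π : Equiv.Perm D} {x y : D} {n : ℕ} (hn : 0 < n)
    (hx : (π ^ n) x = x) (hy : ∀ i < n, (π ^ i) x ≠ y) : ¬ π.SameCycle x y := by
  rintro ⟨i, rfl⟩
  have hpos : (0 : ℤ) < n := by exact_mod_cast hn
  have hfix : ∀ q : ℤ, (π ^ ((n : ℤ) * q)) x = x := fun q => by
    rw [zpow_mul, zpow_natCast]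
    exact zpow_apply_eq_self_of_apply_eq_self hx q
  have h0 := Int.emod_nonneg i hpos.ne'
  have h1 := Int.emod_lt_of_pos i hpos
  refine hy (i % n).toNat (by omega) ?_
  rw [← zpow_natCast, Int.toNat_of_nonneg h0]
  conv_rhs => rw [← Int.emod_add_mul_ediv i n, zpow_add, Equiv.Perm.mul_apply, hfix]

/-- Composing with a transposition of `x` and `y` either joins or splits their cycles. -/
theorem Equiv.Perm.sameCycle_swap_mul_or [Finite D] [DecidableEq D] (π : Equiv.Perm D) {x y : D}
    (hxy : x ≠ y) : (Equiv.swap x y * π).SameCycle x y ∨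
      (π.SameCycle x y ∧ ¬ (Equiv.swap x y * π).SameCycle x y) := by
  have hex : ∃ n, 0 < n ∧ ((π ^ n) x = x ∨ (π ^ n) x = y) := by
    refine ⟨orderOf π, orderOf_pos π, Or.inl ?_⟩
    rw [pow_orderOf_eq_one]; rfl
  classical
  -- `n` is the first time at which the orbit of `x` meets `x` or `y` again. Until then both
  -- permutations agree on it, and at time `n` the transposition exchanges the two outcomes.
  obtain ⟨hn, hret⟩ := Nat.find_spec hex
  have hmin := fun i (hi : i < Nat.find hex) => Nat.find_min hex hi
  generalize Nat.find hex = n at hn hret hmin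
  have hpow : ∀ i < n, ((Equiv.swap x y * π) ^ i) x = (π ^ i) x := by
    intro i
    induction i with
    | zero => simp
    | succ i ih =>
      intro hi
      have h := hmin (i + 1) hi
      simp only [Nat.succ_pos, true_and, not_or] at h
      rw [pow_succ', Equiv.Perm.mul_apply, ih (by omega), Equiv.Perm.mul_apply,
        ← Equiv.Perm.mul_apply π, ← pow_succ']
      exact Equiv.swap_apply_of_ne_of_ne h.1 h.2
  have hlast : ((Equiv.swap x y * π) ^ n) x = Equiv.swap x y ((π ^ n) x) := by
    obtain ⟨m, rfl⟩ : ∃ m, n = m + 1 := ⟨n - 1, by omega⟩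
    rw [pow_succ', Equiv.Perm.mul_apply, hpow m (by omega), Equiv.Perm.mul_apply,
      ← Equiv.Perm.mul_apply π, ← pow_succ']
  rcases hret with h | h
  · left
    exact ⟨n, by rw [zpow_natCast, hlast, h, Equiv.swap_apply_left]⟩
  · right
    refine ⟨⟨n, by rw [zpow_natCast, h]⟩, not_sameCycle_of_pow_eq hn ?_ fun i hi => ?_⟩
    · rw [hlast, h, Equiv.swap_apply_right]
    · rw [hpow i hi]
      rcases Nat.eq_zero_or_pos i with rfl | hi0
      · simpa using hxy
      · have := hmin i hi
        simp only [hi0, true_and, not_or] at this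
        exact this.2

/-- The permutation `σ` and the involution `ι` describe a combinatorial map all of whose components
have genus at most zero: twice the Euler characteristic is at least four times the number of
components. -/
def Equiv.Perm.EulerBound (σ ι : Equiv.Perm D) : Prop :=
  Nat.card D + 4 * Nat.card (Quotient (SameCycle.setoid σ ⊔ SameCycle.setoid ι)) ≤
    2 * σ.numCycles + 2 * (σ * ι).numCycles

/-- Detaching `a` from its cycle in `σ` preserves the Euler bound. -/
theorem Equiv.Perm.EulerBound.swap_mul [Finite D] [DecidableEq D] {σ ι : Equiv.Perm D}
    (h : σ.EulerBound ι) (a : D) : (Equiv.swap a (σ a) * σ).EulerBound ι := by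
  by_cases hfix : σ a = a
  · rw [hfix, Equiv.swap_self]
    exact h
  have hne : a ≠ σ a := fun h' => hfix h'.symm
  have hself : σ.SameCycle a (σ a) := sameCycle_apply_self σ a
  have hv : σ.numCycles < (Equiv.swap a (σ a) * σ).numCycles := by
    refine numCycles_lt_swap_mul hself (not_sameCycle_of_pow_eq one_pos (by simp) ?_)
    intro i hi
    obtain rfl : i = 0 := by omega
    simpa using hne
  have hc : Nat.card (Quotient (SameCycle.setoid (Equiv.swap a (σ a) * σ) ⊔ SameCycle.setoid ι)) ≤
      Nat.card (Quotient (SameCycle.setoid σ ⊔ SameCycle.setoid ι)) + 1 :=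
    Setoid.card_quotient_le_add_one a (σ a) fun t ht hat =>
      sup_le (le_sameCycle_swap_mul (le_sup_left.trans ht) hat) (le_sup_right.trans ht)
  have hf := numCycles_le_swap_mul_add_one (σ * ι) a (σ a)
  have hassoc : Equiv.swap a (σ a) * (σ * ι) = Equiv.swap a (σ a) * σ * ι := (mul_assoc _ _ _).symm
  unfold EulerBound at h ⊢
  -- Detaching gains a vertex. If `a` and `σ a` end on one face, at most one face is lost and they
  -- stay in one component. Otherwise a face is gained too, which pays for at most one new
  -- component.
  rcases sameCycle_swap_mul_or (σ * ι) hne with hjoin | ⟨hsame, hsplit⟩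
  · rw [hassoc] at hf hjoin
    have hle : SameCycle.setoid (Equiv.swap a (σ a) * σ * ι) ≤
        SameCycle.setoid (Equiv.swap a (σ a) * σ) ⊔ SameCycle.setoid ι := by
      refine sameCycle_setoid_le fun z => Setoid.trans' _ (y := ι z) ?_ ?_
      · exact (le_sup_right : SameCycle.setoid ι ≤ _) (sameCycle_apply_self ι z)
      · exact (le_sup_left : SameCycle.setoid (Equiv.swap a (σ a) * σ) ≤ _)
          (sameCycle_apply_self _ (ι z))
    have hc' : Nat.card (Quotient (SameCycle.setoid (Equiv.swap a (σ a) * σ) ⊔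
        SameCycle.setoid ι)) ≤ Nat.card (Quotient (SameCycle.setoid σ ⊔ SameCycle.setoid ι)) :=
      Setoid.card_quotient_le
        (sup_le (le_sameCycle_swap_mul le_sup_left (hle hjoin)) le_sup_right)
    omega
  · have := numCycles_lt_swap_mul hsame hsplit
    rw [hassoc] at this
    omega

/-- Detaching `a` does not affect which other points share a cycle. -/
theorem Equiv.Perm.SameCycle.swap_mul [DecidableEq D] {σ : Equiv.Perm D} {a x y : D}
    (h : σ.SameCycle x y) (hx : x ≠ a) (hy : y ≠ a) :
    (Equiv.swap a (σ a) * σ).SameCycle x y := by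
  by_cases hfix : σ a = a
  · rw [hfix, Equiv.swap_self]
    exact h
  -- `g` slides `a` forward to `σ a`, which turns each step of `σ` into a step of the detached
  -- permutation or into no step.
  let g : D → D := fun z => if z = a then σ a else z
  have key : SameCycle.setoid σ ≤
      (SameCycle.setoid (Equiv.swap a (σ a) * σ)).comap g := by
    refine sameCycle_setoid_le fun z => ?_
    change (Equiv.swap a (σ a) * σ).SameCycle (g z) (g (σ z))
    by_cases hz : z = a
    · simp [g, hz, SameCycle.refl]
    · have h1 : g z = z := if_neg hz
      have h2 : g (σ z) = (Equiv.swap a (σ a) * σ) z := by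
        have h3 : σ z ≠ σ a := fun h => hz (σ.injective h)
        by_cases h4 : σ z = a
        · simp [g, h4]
        · simp [g, h4, Equiv.swap_apply_of_ne_of_ne h4 h3]
      rw [h1, h2]
      exact sameCycle_apply_self _ z
  have := key h
  change (Equiv.swap a (σ a) * σ).SameCycle (g x) (g y) at this
  simpa [g, hx, hy] using this

/-- The number of classes as a sum over all elements. -/
theorem Setoid.sum_inv_ncard [Fintype D] (r : Setoid D) :
    ∑ d : D, ((({x | r d x} : Set D).ncard : ℚ))⁻¹ = Nat.card (Quotient r) := by
  classical
  rw [← Finset.sum_fiberwise (g := fun d => (Quotient.mk r d)), Nat.card_eq_fintype_card,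
    ← Finset.card_univ, Finset.cast_card]
  refine Finset.sum_congr rfl fun q _ => ?_
  obtain ⟨a, rfl⟩ := Quotient.exists_rep q
  have hset : ∀ d, Quotient.mk r d = Quotient.mk r a → {x | r d x} = {x | r a x} := by
    intro d hd
    ext x
    have hda : r d a := Quotient.exact hd
    exact ⟨fun h => r.trans (r.symm hda) h, fun h => r.trans hda h⟩
  rw [Finset.sum_congr rfl (g := fun _ => (({x | r a x} : Set D).ncard : ℚ)⁻¹)
    (fun d hd => by rw [hset d (Finset.mem_filter.1 hd).2]), Finset.sum_const, nsmul_eq_mul]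
  have : ({x | r a x} : Set D) = ↑(Finset.univ.filter fun d => Quotient.mk r d = Quotient.mk r a) := by
    ext x
    simp only [Set.mem_ofPred_eq, Finset.coe_filter, Finset.mem_univ, true_and]
    exact ⟨fun h => Quotient.sound (r.symm h), fun h => r.symm (Quotient.exact h)⟩
  rw [this, Set.ncard_coe_finset]
  refine mul_inv_cancel₀ ?_
  have : a ∈ Finset.univ.filter fun d => Quotient.mk r d = Quotient.mk r a := by simp
  exact_mod_cast (Finset.card_pos.2 ⟨a, this⟩).ne'

end Permutations

/-! ### Plane subgraphs, triangular corners and 5-nets -/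

namespace SimpleGraph

variable {V : Type v} {G : SimpleGraph V}

theorem hasNet_five {a b c d e : V} (hab : G.Adj a b) (hbc : G.Adj b c) (hcd : G.Adj c d)
    (hde : G.Adj d e) (hea : G.Adj e a) (hac : G.Adj a c) (had : a ≠ d) (hbd : b ≠ d)
    (hbe : b ≠ e) (hce : c ≠ e) : G.HasNet 5 := by
  refine ⟨a, .cons hab (.cons hbc (.cons hcd (.cons hde (.cons hea .nil)))), ?_, rfl, s(a, c), ?_⟩
  · have := hab.ne; have := hbc.ne; have := hcd.ne; have := hde.ne; have := hea.ne; have := hac.ne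
    rw [Walk.isCycle_def, Walk.isTrail_def]
    simp only [Walk.edges_cons, Walk.edges_nil, Walk.support_cons, Walk.support_nil]
    refine ⟨?_, by simp, ?_⟩
    · simp; grind
    · simp; grind
  · rw [Walk.isChord_sym2Mk]
    have := hab.ne; have := hbc.ne; have := hcd.ne; have := hde.ne; have := hea.ne; have := hac.ne
    refine ⟨hac, ?_, ?_, ?_⟩
    · simp; grind
    · simp
    · simp

theorem Dart.ext_fst_snd {d d' : G.Dart} (h : d.fst = d'.fst) (h' : d.snd = d'.snd) : d = d' :=
  Dart.ext _ _ (Prod.ext h h')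

/-- Reversal of darts, as a permutation. -/
def dartSymm (G : SimpleGraph V) : Equiv.Perm G.Dart := Dart.symm_involutive.toPerm

/-- `σ` restricts to a rotation system on the subgraph whose set of darts is `S`, and fixes all
other darts. -/
structure IsRotationOn (σ : Equiv.Perm G.Dart) (S : Finset G.Dart) : Prop where
  symm_mem : ∀ d ∈ S, d.symm ∈ S
  apply_of_notMem : ∀ d ∉ S, σ d = d
  fst_apply : ∀ d, (σ d).fst = d.fst
  sameCycle : ∀ d ∈ S, ∀ d' ∈ S, d.fst = d'.fst → σ.SameCycle d d'

open Classical in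
/-- The degree of a vertex in the subgraph whose set of darts is `S`. -/
noncomputable def dartDegree (S : Finset G.Dart) (v : V) : ℕ := (S.filter fun d => d.fst = v).card

theorem dartDegree_le [Fintype V] [DecidableRel G.Adj] (S : Finset G.Dart) (v : V) :
    dartDegree S v ≤ G.maxDegree := by
  classical
  refine le_trans ?_ (G.degree_le_maxDegree v)
  rw [← G.dart_fst_fiber_card_eq_degree v]
  exact Finset.card_le_card (Finset.filter_subset_filter _ (Finset.subset_univ S))

namespace IsRotationOn

variable {σ : Equiv.Perm G.Dart} {S : Finset G.Dart}

theorem symm_mem_iff (h : IsRotationOn σ S) {d : G.Dart} : d.symm ∈ S ↔ d ∈ S :=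
  ⟨fun hd => d.symm_symm ▸ h.symm_mem _ hd, h.symm_mem d⟩

theorem apply_mem_iff (h : IsRotationOn σ S) {d : G.Dart} : σ d ∈ S ↔ d ∈ S := by
  constructor
  · intro hd
    by_contra hn
    exact hn (h.apply_of_notMem d hn ▸ hd)
  · intro hd
    by_contra hn
    exact hn (by rwa [σ.injective (h.apply_of_notMem _ hn)])

theorem face_mem_iff (h : IsRotationOn σ S) {d : G.Dart} : σ d.symm ∈ S ↔ d ∈ S :=
  h.apply_mem_iff.trans h.symm_mem_iff

/-- A return after `k` steps would leave room for only `k` darts in the cycle, which contains all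
darts of `S` at the vertex. -/
theorem pow_apply_ne (h : IsRotationOn σ S) {d : G.Dart} (hd : d ∈ S) {k : ℕ} (hk : 0 < k)
    (hlt : k < dartDegree S d.fst) : (σ ^ k) d ≠ d := by
  classical
  intro hfix
  have hsub : (S.filter fun x => x.fst = d.fst) ⊆
      (Finset.range k).image fun i => (σ ^ i) d := by
    intro x hx
    rw [Finset.mem_filter] at hx
    by_contra hn
    refine not_sameCycle_of_pow_eq hk hfix (y := x) (fun i hi hix => hn ?_)
      (h.sameCycle d hd x hx.1 hx.2.symm)
    exact Finset.mem_image.2 ⟨i, Finset.mem_range.2 hi, hix⟩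
  have := (Finset.card_le_card hsub).trans Finset.card_image_le
  rw [Finset.card_range] at this
  exact absurd hlt (not_lt.2 this)

theorem apply_ne (h : IsRotationOn σ S) {d : G.Dart} (hd : d ∈ S)
    (hlt : 2 ≤ dartDegree S d.fst) : σ d ≠ d := by
  simpa using h.pow_apply_ne hd one_pos (by omega)

theorem apply_apply_ne (h : IsRotationOn σ S) {d : G.Dart} (hd : d ∈ S)
    (hlt : 3 ≤ dartDegree S d.fst) : σ (σ d) ≠ d := by
  exact
    h.pow_apply_ne hd two_pos (by omega)

theorem apply_apply_apply_ne (h : IsRotationOn σ S) {d : G.Dart} (hd : d ∈ S)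
    (hlt : 4 ≤ dartDegree S d.fst) : σ (σ (σ d)) ≠ d := by
  exact
    h.pow_apply_ne hd three_pos (by omega)

theorem dartDegree_le_ncard [Finite V] (h : IsRotationOn σ S) {d : G.Dart} (hd : d ∈ S) :
    dartDegree S d.fst ≤ {x | SameCycle.setoid σ d x}.ncard := by
  classical
  have : Fintype V := Fintype.ofFinite V
  rw [dartDegree, ← Set.ncard_coe_finset]
  refine Set.ncard_le_ncard (fun x hx => ?_) (Set.toFinite _)
  rw [Finset.mem_coe, Finset.mem_filter] at hx
  exact h.sameCycle d hd x hx.1 hx.2.symm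

end IsRotationOn

/-- The face traced from `d` closes after three steps. -/
def IsTriangular (σ : Equiv.Perm G.Dart) (d : G.Dart) : Prop :=
  σ (σ (σ d.symm).symm).symm = d

/-- The face traced from `d` closes after four steps. -/
def IsQuadrangular (σ : Equiv.Perm G.Dart) (d : G.Dart) : Prop :=
  σ (σ (σ (σ d.symm).symm).symm).symm = d

theorem isTriangular_face {σ : Equiv.Perm G.Dart} {d : G.Dart} :
    IsTriangular σ (σ d.symm) ↔ IsTriangular σ d := by
  unfold IsTriangular
  rw [σ.injective.eq_iff, Dart.symm_involutive.injective.eq_iff]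

/-- `σ d` follows `d.symm` on its face. Hence `IsTriangular σ (σ d)` speaks of the corner between
`d` and `σ d`, a convention used throughout. -/
theorem isTriangular_apply {σ : Equiv.Perm G.Dart} {d : G.Dart} :
    IsTriangular σ (σ d) ↔ IsTriangular σ d.symm := by
  rw [← isTriangular_face (d := d.symm), d.symm_symm]

namespace IsRotationOn

variable {σ : Equiv.Perm G.Dart} {S : Finset G.Dart}

theorem fst_face (h : IsRotationOn σ S) (d : G.Dart) : (σ d.symm).fst = d.snd :=
  h.fst_apply _

/-- Consecutive neighbours around a triangular corner are adjacent. -/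
theorem adj_of_isTriangular (h : IsRotationOn σ S) {d : G.Dart} (ht : IsTriangular σ (σ d)) :
    G.Adj d.snd (σ d).snd := by
  rw [isTriangular_apply] at ht
  have h1 : (σ (σ d).symm).symm.symm = (σ (σ d).symm) := Dart.symm_symm _
  unfold IsTriangular at ht
  rw [d.symm_symm] at ht
  have h2 := congrArg (fun x : G.Dart => x.fst) ht
  simp only [h.fst_face] at h2
  have h3 := (σ (σ d).symm).adj
  rw [h.fst_face, h2] at h3
  exact h3.symm

/-- Without 5-nets, a vertex of degree at least four has no three consecutive triangular
corners. -/
theorem not_three_isTriangular (h : IsRotationOn σ S) (hnet : ¬ G.HasNet 5) {d : G.Dart}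
    (hd : d ∈ S) (hdeg : 4 ≤ dartDegree S d.fst) (h1 : IsTriangular σ (σ d))
    (h2 : IsTriangular σ (σ (σ d))) (h3 : IsTriangular σ (σ (σ (σ d)))) : False := by
  have ha1 := h.adj_of_isTriangular h1
  have ha2 := h.adj_of_isTriangular h2
  have ha3 := h.adj_of_isTriangular h3
  have f1 : (σ d).fst = d.fst := h.fst_apply _
  have f2 : (σ (σ d)).fst = d.fst := (h.fst_apply _).trans f1
  have f3 : (σ (σ (σ d))).fst = d.fst := (h.fst_apply _).trans f2
  have n1 : σ d ≠ d := h.apply_ne hd (by omega)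
  have n2 : σ (σ d) ≠ d := h.apply_apply_ne hd (by omega)
  have n3 : σ (σ (σ d)) ≠ d := h.apply_apply_apply_ne hd hdeg
  have n4 : σ (σ (σ d)) ≠ σ d := fun h => n2 (σ.injective h)
  -- The vertex and four consecutive neighbours form the 5-cycle; the spoke to the second neighbour
  -- is the chord.
  refine hnet (hasNet_five (a := d.fst) (b := d.snd) (c := (σ d).snd) (d := (σ (σ d)).snd)
    (e := (σ (σ (σ d))).snd) d.adj ha1 ha2 ha3 ?_ ?_ ?_ ?_ ?_ ?_)
  · exact f3 ▸ (σ (σ (σ d))).adj.symm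
  · exact f1 ▸ (σ d).adj
  · exact f2 ▸ (σ (σ d)).fst_ne_snd
  · exact fun e => n2 (Dart.ext_fst_snd f2 e.symm)
  · exact fun e => n3 (Dart.ext_fst_snd f3 e.symm)
  · exact fun e => n4 (Dart.ext_fst_snd (f3.trans f1.symm) e.symm)

/-- Without 5-nets, a triangular face is not next to a quadrangular one. -/
theorem not_isQuadrangular_symm (h : IsRotationOn σ S) (hnet : ¬ G.HasNet 5)
    (hdeg : ∀ d ∈ S, 3 ≤ dartDegree S d.fst) {d : G.Dart} (hd : d ∈ S) (ht : IsTriangular σ d) :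
    ¬ IsQuadrangular σ d.symm := by
  intro hq
  unfold IsTriangular at ht
  unfold IsQuadrangular at hq
  rw [d.symm_symm] at hq
  obtain ⟨q, rfl⟩ : ∃ q : G.Dart, q.symm = d := ⟨d.symm, d.symm_symm⟩
  rw [Dart.symm_symm] at ht hq
  have hqS : q ∈ S := h.symm_mem_iff.1 hd
  -- `t1 = σ q` and `t2` follow `q.symm` in the triangle; `r1`, `r2`, `r3` follow `q` in the
  -- quadrangle.
  generalize ht1 : σ q = t1 at ht
  generalize ht2 : σ t1.symm = t2 at ht
  generalize hr1 : σ q.symm = r1 at hq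
  generalize hr2 : σ r1.symm = r2 at hq
  generalize hr3 : σ r2.symm = r3 at hq
  have mt1 : t1 ∈ S := ht1 ▸ h.apply_mem_iff.2 hqS
  have mt2 : t2 ∈ S := ht2 ▸ h.face_mem_iff.2 mt1
  have mr1 : r1 ∈ S := hr1 ▸ h.face_mem_iff.2 hqS
  have mr2 : r2 ∈ S := hr2 ▸ h.face_mem_iff.2 mr1
  have mr3 : r3 ∈ S := hr3 ▸ h.face_mem_iff.2 mr2
  have ne1 : ∀ x ∈ S, σ x ≠ x := fun x hx => h.apply_ne hx (by have := hdeg x hx; omega)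
  have ne2 : ∀ x ∈ S, σ (σ x) ≠ x := fun x hx => h.apply_apply_ne hx (hdeg x hx)
  have et1 : t1.fst = q.fst := ht1 ▸ h.fst_apply q
  have et2 : t2.fst = t1.snd := ht2 ▸ h.fst_apply _
  have et3 : q.snd = t2.snd := by
    have := congrArg (fun x : G.Dart => x.fst) ht
    exact (this.symm.trans (h.fst_apply _))
  have er1 : r1.fst = q.snd := hr1 ▸ h.fst_apply _
  have er2 : r2.fst = r1.snd := hr2 ▸ h.fst_apply _
  have er3 : r3.fst = r2.snd := hr3 ▸ h.fst_apply _
  have er4 : q.fst = r3.snd := by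
    have := congrArg (fun x : G.Dart => x.fst) hq
    exact (this.symm.trans (h.fst_apply _))
  have at1 := t1.adj
  have at2 := t2.adj
  have ar1 := r1.adj
  have ar2 := r2.adj
  have ar3 := r3.adj
  rw [et1] at at1
  rw [et2, ← et3] at at2
  rw [er1] at ar1
  rw [er2] at ar2
  rw [er3, ← er4] at ar3
  -- A coincidence among the five vertices would make `σ` or its square fix a dart, against minimum
  -- degree 3.
  have y1 : r1.snd ≠ q.fst := by
    intro e
    have : r1 = q.symm := Dart.ext_fst_snd er1 e
    exact ne1 _ hd (hr1.trans this)
  have y2 : r2.snd ≠ q.snd := by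
    intro e
    have : r2 = r1.symm := Dart.ext_fst_snd er2 (e.trans er1.symm)
    exact ne1 _ (h.symm_mem _ mr1) (hr2.trans this)
  have y3 : r2.snd ≠ t1.snd := by
    intro e
    have : r3.symm = t1 := Dart.ext_fst_snd (er4.symm.trans et1.symm) (er3.trans e)
    exact ne2 _ mt1 (by rw [← this, hq, ht1, ← this])
  have y4 : r1.snd ≠ t1.snd := by
    intro e
    have : r1 = t2.symm := Dart.ext_fst_snd (er1.trans et3) (e.trans et2.symm)
    exact ne2 _ mr1 (by rw [this, ht, hr1, this])
  -- The boundary of triangle and quadrangle together is the 5-cycle; the shared edge `q` is its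
  -- chord.
  exact hnet (hasNet_five (a := q.fst) (b := t1.snd) (c := q.snd) (d := r1.snd) (e := r2.snd)
    at1 at2 ar1 ar2 ar3 q.adj y1.symm y4.symm y3.symm y2.symm)

end IsRotationOn

/-! ### Discharging -/

open Classical in
/-- The indicator of a proposition. -/
noncomputable def indicator (p : Prop) : ℚ := if p then 1 else 0

theorem indicator_of {p : Prop} (h : p) : indicator p = 1 := if_pos h

theorem indicator_of_not {p : Prop} (h : ¬ p) : indicator p = 0 := if_neg h

theorem indicator_nonneg (p : Prop) : 0 ≤ indicator p := by
  unfold indicator; split_ifs <;> norm_num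

theorem indicator_le_one (p : Prop) : indicator p ≤ 1 := by
  unfold indicator; split_ifs <;> norm_num

theorem indicator_eq_zero_or_one (p : Prop) : indicator p = 0 ∨ indicator p = 1 := by
  unfold indicator; split_ifs <;> simp

theorem indicator_add_le_one {p q : Prop} (h : p → ¬ q) : indicator p + indicator q ≤ 1 := by
  by_cases hp : p
  · rw [indicator_of hp, indicator_of_not (h hp)]; norm_num
  · rw [indicator_of_not hp]; linarith [indicator_le_one q]

theorem one_le_indicator_add {p q : Prop} (h : p ∨ q) : 1 ≤ indicator p + indicator q := by
  rcases h with hp | hq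
  · rw [indicator_of hp]; linarith [indicator_nonneg q]
  · rw [indicator_of hq]; linarith [indicator_nonneg p]

theorem indicator_add_le_of_and {p q r : Prop} (h : p → q → r) :
    indicator p + indicator q ≤ 1 + indicator r := by
  by_cases hr : r
  · rw [indicator_of hr]; linarith [indicator_le_one p, indicator_le_one q]
  · rw [indicator_of_not hr]
    linarith [indicator_add_le_one (p := p) (q := q) fun hp hq => hr (h hp hq)]

/-- A vertex of degree three in the subgraph given by `S`, all of whose corners are triangular. -/
def IsWheelCentre (σ : Equiv.Perm G.Dart) (S : Finset G.Dart) (v : V) : Prop :=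
  dartDegree S v = 3 ∧ ∀ d ∈ S, d.fst = v → IsTriangular σ d

/-- The degree conditions satisfied by a subgraph without light edges. -/
structure NoLightDart (S : Finset G.Dart) : Prop where
  three_le : ∀ d ∈ S, 3 ≤ dartDegree S d.fst
  of_three : ∀ d ∈ S, dartDegree S d.fst = 3 → 7 ≤ dartDegree S d.snd
  of_four : ∀ d ∈ S, dartDegree S d.fst = 4 → 5 ≤ dartDegree S d.snd

theorem NoLightDart.five_le {S : Finset G.Dart} (hS : NoLightDart S) {d : G.Dart} (hd : d ∈ S) :
    5 ≤ dartDegree S d.fst ∨ 5 ≤ dartDegree S d.snd := by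
  have h1 := hS.three_le d hd
  have h2 := hS.of_three d hd
  have h3 := hS.of_four d hd
  omega

namespace IsRotationOn

variable {σ : Equiv.Perm G.Dart} {S : Finset G.Dart}

theorem sum_symm (h : IsRotationOn σ S) (g : G.Dart → ℚ) :
    ∑ d ∈ S, g d.symm = ∑ d ∈ S, g d :=
  Finset.sum_equiv G.dartSymm (fun _ => h.symm_mem_iff.symm) fun _ _ => rfl

theorem sum_apply (h : IsRotationOn σ S) (g : G.Dart → ℚ) :
    ∑ d ∈ S, g (σ d) = ∑ d ∈ S, g d :=
  Finset.sum_equiv σ (fun _ => h.apply_mem_iff.symm) fun _ _ => rfl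

theorem sum_face (h : IsRotationOn σ S) (g : G.Dart → ℚ) :
    ∑ d ∈ S, g (σ d.symm) = ∑ d ∈ S, g d :=
  (h.sum_symm fun d => g (σ d)).trans (h.sum_apply g)

/-- The third side of the triangle lies in `S` and not only in `G`, so the degree conditions apply
to it. -/
theorem exists_dart_of_isTriangular (h : IsRotationOn σ S) {d : G.Dart} (hd : d ∈ S)
    (ht : IsTriangular σ (σ d)) : ∃ x ∈ S, x.fst = d.snd ∧ x.snd = (σ d).snd := by
  rw [isTriangular_apply] at ht
  unfold IsTriangular at ht
  rw [d.symm_symm] at ht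
  have h2 := congrArg (fun x : G.Dart => x.fst) ht
  simp only [h.fst_face] at h2
  exact ⟨(σ (σ d).symm).symm, h.symm_mem _ (h.face_mem_iff.2 (h.apply_mem_iff.2 hd)), h2,
    h.fst_face _⟩

theorem eq_or_eq_apply_of_fst_eq (h : IsRotationOn σ S) {d : G.Dart} (hd : d ∈ S)
    (hdeg : dartDegree S d.fst = 3) {x : G.Dart} (hx : x ∈ S) (hfst : x.fst = d.fst) :
    x = d ∨ x = σ d ∨ x = σ (σ d) := by
  classical
  have n1 : σ d ≠ d := h.apply_ne hd (by omega)
  have n2 : σ (σ d) ≠ d := h.apply_apply_ne hd (by omega)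
  have n3 : σ (σ d) ≠ σ d := fun e => n1 (σ.injective e)
  have hsub : ({d, σ d, σ (σ d)} : Finset G.Dart) ⊆ S.filter fun x => x.fst = d.fst := by
    intro y hy
    simp only [Finset.mem_insert, Finset.mem_singleton] at hy
    rw [Finset.mem_filter]
    rcases hy with rfl | rfl | rfl
    · exact ⟨hd, rfl⟩
    · exact ⟨h.apply_mem_iff.2 hd, h.fst_apply _⟩
    · exact ⟨h.apply_mem_iff.2 (h.apply_mem_iff.2 hd), (h.fst_apply _).trans (h.fst_apply _)⟩
  have hcard : ({d, σ d, σ (σ d)} : Finset G.Dart).card = 3 :=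
    Finset.card_eq_three.2 ⟨_, _, _, n1.symm, n2.symm, n3.symm, rfl⟩
  have heq := Finset.eq_of_subset_of_card_le hsub (by rw [hcard]; exact hdeg.le)
  have : x ∈ S.filter fun x => x.fst = d.fst := Finset.mem_filter.2 ⟨hx, hfst⟩
  rw [← heq] at this
  simpa using this

/-- A vertex with three consecutive triangular corners is the centre of a wheel. -/
theorem isWheelCentre (h : IsRotationOn σ S) (hnet : ¬ G.HasNet 5) (hS : NoLightDart S)
    {d : G.Dart} (hd : d ∈ S) (ht : IsTriangular σ d) (h1 : IsTriangular σ d.symm)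
    (h2 : IsTriangular σ (σ d.symm).symm) : IsWheelCentre σ S d.snd := by
  obtain ⟨x, hx⟩ : ∃ x, σ x = d.symm := σ.surjective _
  have hdS := h.symm_mem d hd
  have hxS : x ∈ S := h.apply_mem_iff.1 (hx ▸ hdS)
  have hxf : x.fst = d.snd := by rw [← h.fst_apply, hx]; rfl
  have t1 : IsTriangular σ (σ d.symm) := isTriangular_face.2 ht
  have t2 : IsTriangular σ (σ (σ d.symm)) := isTriangular_apply.2 h2
  have hdeg : dartDegree S d.snd = 3 := by
    have h3 := hS.three_le x hxS
    rw [hxf] at h3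
    by_contra hne
    exact h.not_three_isTriangular hnet hxS (by rw [hxf]; omega) (by rwa [hx]) (by rwa [hx])
      (by rwa [hx])
  refine ⟨hdeg, fun y hy hyf => ?_⟩
  rcases h.eq_or_eq_apply_of_fst_eq hdS hdeg hy hyf with rfl | rfl | rfl
  · exact h1
  · exact t1
  · exact t2

/-- The charge of a dart as seen from its face, after discharging. -/
noncomputable def faceCharge (σ : Equiv.Perm G.Dart) (S : Finset G.Dart) (d : G.Dart) : ℚ :=
  -- The first line and the next leave 1 - 4/l for l = 5, 4, 3, that is 1/5, 0, -1/3; longer faces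
  -- are counted as l = 5. Then come the gifts from vertices, from wheel centres and across edges.
  1 / 5 - 1 / 5 * indicator (IsQuadrangular σ d ∧ ¬ IsTriangular σ d)
    - 8 / 15 * indicator (IsTriangular σ d)
    + 3 / 10 * indicator (IsTriangular σ d ∧ 5 ≤ dartDegree S d.fst)
    + 1 / 5 * indicator (IsWheelCentre σ S d.fst)
    + 1 / 5 * indicator (IsTriangular σ d ∧ ¬ IsTriangular σ d.symm)
    - 1 / 5 * indicator (IsTriangular σ d.symm ∧ ¬ IsTriangular σ d)

/-- A face of length at least 5 has 1/5 for each edge, the most it gives across it. A quadrangular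
face has nothing, but no triangular neighbour either. -/
theorem faceCharge_nonneg (h : IsRotationOn σ S) (hnet : ¬ G.HasNet 5) (hS : NoLightDart S)
    {d : G.Dart} (hd : d ∈ S) (ht : ¬ IsTriangular σ d) : 0 ≤ faceCharge σ S d := by
  unfold faceCharge
  rw [indicator_of_not ht, indicator_of_not (fun h : _ ∧ _ => ht h.1),
    indicator_of_not (fun h : _ ∧ _ => ht h.1)]
  have h1 := indicator_nonneg (IsWheelCentre σ S d.fst)
  have h2 := indicator_add_le_one (p := IsQuadrangular σ d ∧ ¬ IsTriangular σ d)
    (q := IsTriangular σ d.symm ∧ ¬ IsTriangular σ d) fun hq hs =>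
      h.not_isQuadrangular_symm hnet hS.three_le (h.symm_mem d hd) hs.1 (by
        rw [d.symm_symm]; exact hq.1)
  linarith

theorem faceCharge_of_isTriangular {d : G.Dart} (ht : IsTriangular σ d) :
    faceCharge σ S d = -1 / 3 + 3 / 10 * indicator (5 ≤ dartDegree S d.fst)
      + 1 / 5 * indicator (IsWheelCentre σ S d.fst)
      + 1 / 5 * (1 - indicator (IsTriangular σ d.symm)) := by
  unfold faceCharge
  rw [indicator_of ht, indicator_of_not (p := IsQuadrangular σ d ∧ ¬ _) (fun h => h.2 ht),
    indicator_of_not (p := IsTriangular σ d.symm ∧ ¬ _) (fun h => h.2 ht), and_iff_right ht, and_iff_right ht]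
  by_cases hs : IsTriangular σ d.symm
  · rw [indicator_of hs, indicator_of_not (not_not.2 hs)]; ring
  · rw [indicator_of_not hs, indicator_of hs]; ring

/-- A triangle starts at -1 and gets at least 2 · 3/10 from its vertices of degree at least 5. The
missing 2/5 comes across two edges to non-triangular faces, or across one such edge and from the
wheel centre opposite to it. -/
theorem sum_three_faceCharge_nonneg (h : IsRotationOn σ S) (hnet : ¬ G.HasNet 5)
    (hS : NoLightDart S) {d : G.Dart} (hd : d ∈ S) :
    0 ≤ faceCharge σ S d + faceCharge σ S (σ d.symm)
      + faceCharge σ S (σ (σ d.symm).symm) := by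
  have hd1 : σ d.symm ∈ S := h.face_mem_iff.2 hd
  have hd2 : σ (σ d.symm).symm ∈ S := h.face_mem_iff.2 hd1
  have hf1 : (σ d.symm).fst = d.snd := h.fst_face d
  have hf2 : (σ (σ d.symm).symm).fst = (σ d.symm).snd := h.fst_face _
  by_cases ht : IsTriangular σ d
  · have ht1 : IsTriangular σ (σ d.symm) := isTriangular_face.2 ht
    have ht2 : IsTriangular σ (σ (σ d.symm).symm) := isTriangular_face.2 ht1
    have hclose : σ (σ (σ d.symm).symm).symm = d := ht
    have hf3 : d.fst = (σ (σ d.symm).symm).snd := by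
      conv_lhs => rw [← hclose]
      exact h.fst_face _
    rw [faceCharge_of_isTriangular ht, faceCharge_of_isTriangular ht1,
      faceCharge_of_isTriangular ht2]
    have w1 := indicator_add_le_of_and (h.isWheelCentre hnet hS hd ht)
    have w2 := indicator_add_le_of_and (h.isWheelCentre hnet hS hd1 ht1)
    have w3 := indicator_add_le_of_and (h.isWheelCentre hnet hS hd2 ht2)
    -- Triangles across all three edges would make adjacent vertices wheel centres, hence both of
    -- degree 3.
    have hall : IsTriangular σ d.symm → IsTriangular σ (σ d.symm).symm →
        ¬ IsTriangular σ (σ (σ d.symm).symm).symm := by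
      intro a1 a2 a3
      have c1 := (h.isWheelCentre hnet hS hd ht a1 a2).1
      have c2 := (h.isWheelCentre hnet hS hd1 ht1 a2 a3).1
      rw [← hf1] at c1
      have := hS.of_three _ hd1 c1
      omega
    have p1 := one_le_indicator_add (hS.five_le hd)
    have p2 := one_le_indicator_add (hS.five_le hd1)
    have p3 := one_le_indicator_add (hS.five_le hd2)
    rw [hclose] at w3
    rw [← hf1] at w1 p1
    rw [← hf2] at w2 p2
    rw [← hf3] at w3 p3
    have k1 := indicator_nonneg (IsWheelCentre σ S d.fst)
    have k2 := indicator_nonneg (IsWheelCentre σ S (σ d.symm).fst)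
    have k3 := indicator_nonneg (IsWheelCentre σ S (σ (σ d.symm).symm).fst)
    have hp : 2 ≤ indicator (5 ≤ dartDegree S d.fst)
        + indicator (5 ≤ dartDegree S (σ d.symm).fst)
        + indicator (5 ≤ dartDegree S (σ (σ d.symm).symm).fst) := by
      rcases indicator_eq_zero_or_one (5 ≤ dartDegree S d.fst) with e1 | e1 <;>
      rcases indicator_eq_zero_or_one (5 ≤ dartDegree S (σ d.symm).fst) with e2 | e2 <;>
      linarith
    by_cases a1 : IsTriangular σ d.symm <;> by_cases a2 : IsTriangular σ (σ d.symm).symm <;>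
    by_cases a3 : IsTriangular σ (σ (σ d.symm).symm).symm
    · exact absurd a3 (hall a1 a2)
    all_goals simp only [indicator_of, indicator_of_not, a1, a2, a3, not_false_eq_true] at w1 w2 w3 ⊢
    all_goals linarith
  · have ht1 : ¬ IsTriangular σ (σ d.symm) := fun h => ht (isTriangular_face.1 h)
    have ht2 : ¬ IsTriangular σ (σ (σ d.symm).symm) := fun h => ht1 (isTriangular_face.1 h)
    have := h.faceCharge_nonneg hnet hS hd ht
    have := h.faceCharge_nonneg hnet hS hd1 ht1
    have := h.faceCharge_nonneg hnet hS hd2 ht2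
    linarith

/-- Summing over `d` and its next two successors on the face counts every dart three times, so no
grouping by faces is needed. -/
theorem sum_faceCharge_nonneg (h : IsRotationOn σ S) (hnet : ¬ G.HasNet 5)
    (hS : NoLightDart S) : 0 ≤ ∑ d ∈ S, faceCharge σ S d := by
  have h1 := h.sum_face (faceCharge σ S)
  have h2 := h.sum_face fun d => faceCharge σ S (σ d.symm)
  have h3 := Finset.sum_nonneg fun d hd => h.sum_three_faceCharge_nonneg hnet hS (d := d) hd
  rw [Finset.sum_add_distrib, Finset.sum_add_distrib] at h3
  linarith

/-- The charge of a dart as seen from its first vertex, after discharging. -/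
noncomputable def vertexCharge (σ : Equiv.Perm G.Dart) (S : Finset G.Dart) (d : G.Dart) : ℚ :=
  -- In order: the share of the initial charge, the gift to a triangle, the 1/3 received by a
  -- 3-vertex or given to one, and the 1/5 given to a wheel centre.
  1 - 4 / dartDegree S d.fst - 3 / 10 * indicator (IsTriangular σ d ∧ 5 ≤ dartDegree S d.fst)
    + 1 / 3 * indicator (dartDegree S d.fst = 3) - 1 / 3 * indicator (dartDegree S d.snd = 3)
    - 1 / 5 * indicator (IsWheelCentre σ S d.snd)

theorem isTriangular_of_isWheelCentre (h : IsRotationOn σ S) {d : G.Dart} (hd : d ∈ S)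
    (hw : IsWheelCentre σ S d.snd) : IsTriangular σ d ∧ IsTriangular σ (σ d) :=
  ⟨isTriangular_face.1 (hw.2 _ (h.face_mem_iff.2 hd) (h.fst_face d)),
    isTriangular_apply.2 (hw.2 _ (h.symm_mem _ hd) rfl)⟩

/-- Otherwise the third side of the triangle would join two 3-vertices. -/
theorem not_three_of_isTriangular (h : IsRotationOn σ S) (hS : NoLightDart S) {d : G.Dart}
    (hd : d ∈ S) (ht : IsTriangular σ (σ d)) (h3 : dartDegree S d.snd = 3) :
    dartDegree S (σ d).snd ≠ 3 := by
  obtain ⟨x, hx, hx1, hx2⟩ := h.exists_dart_of_isTriangular hd ht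
  have := hS.of_three x hx (hx1 ▸ h3)
  rw [hx2] at this
  omega

/-- The share of the charge of a vertex of degree at least seven claimed around one corner. -/
theorem corner_le_two (h : IsRotationOn σ S) (hnet : ¬ G.HasNet 5) (hS : NoLightDart S)
    {d : G.Dart} (hd : d ∈ S) (hdeg : 7 ≤ dartDegree S d.fst) :
    indicator (dartDegree S (σ d).snd = 3) + indicator (dartDegree S (σ (σ d)).snd = 3)
      + indicator (IsTriangular σ (σ (σ d))) + indicator (IsWheelCentre σ S (σ (σ (σ d))).snd)
      + indicator (IsWheelCentre σ S d.snd) ≤ 2 := by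
  have hd1 : σ d ∈ S := h.apply_mem_iff.2 hd
  have hd2 : σ (σ d) ∈ S := h.apply_mem_iff.2 hd1
  have hd3 : σ (σ (σ d)) ∈ S := h.apply_mem_iff.2 hd2
  -- A wheel centre at the end of `d` also makes the corner before `d` triangular, so the preceding
  -- dart `x` is needed.
  obtain ⟨x, rfl⟩ : ∃ x, σ x = d := σ.surjective _
  have hx : x ∈ S := h.apply_mem_iff.1 hd
  rw [h.fst_apply] at hdeg
  have q1 := indicator_add_le_one (p := IsWheelCentre σ S (σ (σ (σ (σ x)))).snd)
    (q := dartDegree S (σ (σ (σ x))).snd = 3) fun hw h3 =>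
      h.not_three_of_isTriangular hS hd2 (h.isTriangular_of_isWheelCentre hd3 hw).1 h3 hw.1
  have q2 := indicator_add_le_one (p := IsWheelCentre σ S (σ (σ (σ (σ x)))).snd)
    (q := IsTriangular σ (σ (σ (σ x)))) fun hw ht =>
      have := h.isTriangular_of_isWheelCentre hd3 hw
      h.not_three_isTriangular hnet hd1 (by rw [h.fst_apply, h.fst_apply]; omega) ht this.1 this.2
  have q3 := indicator_add_le_one (p := IsWheelCentre σ S (σ x).snd)
    (q := dartDegree S (σ (σ x)).snd = 3) fun hw =>
      h.not_three_of_isTriangular hS hd (h.isTriangular_of_isWheelCentre hd hw).2 hw.1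
  have q4 := indicator_add_le_one (p := IsWheelCentre σ S (σ x).snd)
    (q := IsTriangular σ (σ (σ (σ x)))) fun hw ht =>
      have := h.isTriangular_of_isWheelCentre hd hw
      h.not_three_isTriangular hnet hx (by omega) this.1 this.2 ht
  -- A triangular middle corner excludes both wheel centres and one of the two 3-vertices. Otherwise
  -- each 3-vertex is paired with the wheel centre beside it, and each pair counts at most one.
  by_cases ht : IsTriangular σ (σ (σ (σ x)))
  · have q5 := indicator_add_le_one (p := dartDegree S (σ (σ x)).snd = 3)
      (q := dartDegree S (σ (σ (σ x))).snd = 3) (h.not_three_of_isTriangular hS hd1 ht)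
    rw [indicator_of ht] at q2 q4 ⊢
    linarith
  · rw [indicator_of_not ht]
    linarith

theorem triangular_corners_le_two (h : IsRotationOn σ S) (hnet : ¬ G.HasNet 5) {d : G.Dart}
    (hd : d ∈ S) (hdeg : 4 ≤ dartDegree S d.fst) :
    indicator (IsTriangular σ (σ d)) + indicator (IsTriangular σ (σ (σ d)))
      + indicator (IsTriangular σ (σ (σ (σ d)))) ≤ 2 := by
  by_cases h1 : IsTriangular σ (σ d)
  · have := indicator_add_le_one (p := IsTriangular σ (σ (σ d)))
      (h.not_three_isTriangular hnet hd hdeg h1)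
    linarith [indicator_le_one (IsTriangular σ (σ d))]
  · rw [indicator_of_not h1]
    linarith [indicator_le_one (IsTriangular σ (σ (σ d))),
      indicator_le_one (IsTriangular σ (σ (σ (σ d))))]

/-- Every gift is spread over nearby darts of the rotation, so that the inequality holds dart by
dart; summing over `S` undoes the shifts. -/
theorem sum_vertexCharge_nonneg (h : IsRotationOn σ S) (hnet : ¬ G.HasNet 5)
    (hS : NoLightDart S) : 0 ≤ ∑ d ∈ S, vertexCharge σ S d := by
  let τ : G.Dart → ℚ := fun d => indicator (IsTriangular σ d)
  let s : G.Dart → ℚ := fun d => indicator (dartDegree S d.snd = 3)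
  let k : G.Dart → ℚ := fun d => indicator (IsWheelCentre σ S d.snd)
  let c : G.Dart → ℚ := fun d =>
    indicator (dartDegree S d.fst = 5 ∨ dartDegree S d.fst = 6)
  let e : G.Dart → ℚ := fun d => indicator (7 ≤ dartDegree S d.fst)
  have hc : ∀ d, c (σ d) = c d := fun d => by simp only [c, h.fst_apply]
  have he : ∀ d, e (σ d) = e d := fun d => by simp only [e, h.fst_apply]
  have shift : ∀ g : G.Dart → ℚ, ∑ d ∈ S, g (σ (σ d)) = ∑ d ∈ S, g d := fun g =>
    (h.sum_apply fun d => g (σ d)).trans (h.sum_apply g)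
  have shift' : ∀ g : G.Dart → ℚ, ∑ d ∈ S, g (σ (σ (σ d))) = ∑ d ∈ S, g d := fun g =>
    (shift fun d => g (σ d)).trans (h.sum_apply g)
  -- Degrees 5 and 6: at most 2 · 1/10 = 1 - 4/5. Degree at least 7: at most 2 · 1/6 + 2 · 2/45 =
  -- 19/45, below 3/7 = 1 - 4/7.
  have hlocal : ∀ d ∈ S, c d * (1 / 10 * (τ (σ d) + τ (σ (σ d)) + τ (σ (σ (σ d)))))
      + e d * (1 / 6 * (s (σ d) + s (σ (σ d)) + τ (σ (σ d)) + k (σ (σ (σ d))) + k d)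
        + 2 / 45 * (τ (σ d) + τ (σ (σ d)) + τ (σ (σ (σ d))))) ≤
      1 - 4 / dartDegree S d.fst + 1 / 3 * indicator (dartDegree S d.fst = 3) := by
    intro d hd
    have h3 := hS.three_le d hd
    simp only [c, e]
    rcases lt_or_ge (dartDegree S d.fst) 5 with h5 | h5
    · rw [indicator_of_not (p := _ ∨ _) (by omega), indicator_of_not (p := 7 ≤ _) (by omega)]
      have : dartDegree S d.fst = 3 ∨ dartDegree S d.fst = 4 := by omega
      rcases this with e | e <;> rw [e]
      · rw [indicator_of rfl]; norm_num
      · rw [indicator_of_not (by norm_num)]; norm_num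
    have ht := h.triangular_corners_le_two hnet hd (by omega)
    rw [indicator_of_not (p := _ = 3) (by omega)]
    rcases lt_or_ge (dartDegree S d.fst) 7 with h7 | h7
    · rw [indicator_of (p := _ ∨ _) (by omega), indicator_of_not (p := 7 ≤ _) (by omega)]
      have : (4 : ℚ) / dartDegree S d.fst ≤ 4 / 5 := by
        gcongr; exact_mod_cast h5
      linarith
    · rw [indicator_of_not (p := _ ∨ _) (by omega), indicator_of (p := 7 ≤ _) h7]
      have hw := h.corner_le_two hnet hS hd h7
      have : (4 : ℚ) / dartDegree S d.fst ≤ 4 / 7 := by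
        gcongr; exact_mod_cast h7
      linarith
  have hsum := Finset.sum_le_sum hlocal
  -- The coefficient of `τ` at degree at least 7 is 1/6 + 3 · 2/45 = 3/10. That of `k` is 1/3, more
  -- than the 1/5 required.
  have hrearrange : ∑ d ∈ S, (c d * (1 / 10 * (τ (σ d) + τ (σ (σ d)) + τ (σ (σ (σ d)))))
      + e d * (1 / 6 * (s (σ d) + s (σ (σ d)) + τ (σ (σ d)) + k (σ (σ (σ d))) + k d)
        + 2 / 45 * (τ (σ d) + τ (σ (σ d)) + τ (σ (σ (σ d)))))) =
      ∑ d ∈ S, (3 / 10 * (c d * τ d) + 3 / 10 * (e d * τ d) + 1 / 3 * (e d * s d)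
        + 1 / 3 * (e d * k d)) := by
    have a1 := h.sum_apply fun d => c d * τ d
    have a2 := shift fun d => c d * τ d
    have a3 := shift' fun d => c d * τ d
    have b1 := h.sum_apply fun d => e d * τ d
    have b2 := shift fun d => e d * τ d
    have b3 := shift' fun d => e d * τ d
    have d1 := h.sum_apply fun d => e d * s d
    have d2 := shift fun d => e d * s d
    have f3 := shift' fun d => e d * k d
    simp only [hc, he] at a1 a2 a3 b1 b2 b3 d1 d2 f3
    calc _ = 1 / 10 * (∑ d ∈ S, c d * τ (σ d)) + 1 / 10 * (∑ d ∈ S, c d * τ (σ (σ d)))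
          + 1 / 10 * (∑ d ∈ S, c d * τ (σ (σ (σ d))))
          + 1 / 6 * (∑ d ∈ S, e d * s (σ d)) + 1 / 6 * (∑ d ∈ S, e d * s (σ (σ d)))
          + 1 / 6 * (∑ d ∈ S, e d * τ (σ (σ d)))
          + 1 / 6 * (∑ d ∈ S, e d * k (σ (σ (σ d)))) + 1 / 6 * (∑ d ∈ S, e d * k d)
          + 2 / 45 * (∑ d ∈ S, e d * τ (σ d)) + 2 / 45 * (∑ d ∈ S, e d * τ (σ (σ d)))
          + 2 / 45 * (∑ d ∈ S, e d * τ (σ (σ (σ d)))) := by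
            simp only [Finset.mul_sum, ← Finset.sum_add_distrib]
            exact Finset.sum_congr rfl fun d _ => by ring
      _ = 3 / 10 * (∑ d ∈ S, c d * τ d) + 3 / 10 * (∑ d ∈ S, e d * τ d)
          + 1 / 3 * (∑ d ∈ S, e d * s d) + 1 / 3 * (∑ d ∈ S, e d * k d) := by
            rw [a1, a2, a3, b1, b2, b3, d1, d2, f3]; ring
      _ = _ := by simp only [Finset.mul_sum, ← Finset.sum_add_distrib]
  rw [hrearrange] at hsum
  have hdiff : ∀ d ∈ S, (1 - 4 / dartDegree S d.fst + 1 / 3 * indicator (dartDegree S d.fst = 3))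
      - (3 / 10 * (c d * τ d) + 3 / 10 * (e d * τ d) + 1 / 3 * (e d * s d)
        + 1 / 3 * (e d * k d)) ≤ vertexCharge σ S d := by
    intro d hd
    have hs : e d * s d = s d := by
      by_cases h3 : dartDegree S d.snd = 3
      · have : 7 ≤ dartDegree S d.fst := hS.of_three d.symm (h.symm_mem d hd) h3
        simp only [e, s, indicator_of this, one_mul]
      · simp only [s, indicator_of_not h3, mul_zero]
    have hk : e d * k d = k d := by
      by_cases h3 : IsWheelCentre σ S d.snd
      · have : 7 ≤ dartDegree S d.fst := hS.of_three d.symm (h.symm_mem d hd) h3.1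
        simp only [e, k, indicator_of this, one_mul]
      · simp only [k, indicator_of_not h3, mul_zero]
    have hce : c d * τ d + e d * τ d =
        indicator (IsTriangular σ d ∧ 5 ≤ dartDegree S d.fst) := by
      by_cases ht : IsTriangular σ d
      · simp only [τ, c, e, indicator_of ht, mul_one, and_iff_right ht]
        rcases lt_or_ge (dartDegree S d.fst) 7 with h7 | h7
        · rw [indicator_of_not (p := 7 ≤ _) (by omega), add_zero]
          congr 1
          rw [eq_iff_iff]
          omega
        · rw [indicator_of_not (p := _ ∨ _) (by omega), indicator_of (p := 7 ≤ _) h7,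
            indicator_of (by omega)]
          norm_num
      · simp only [τ, indicator_of_not ht, indicator_of_not (fun h : _ ∧ _ => ht h.1)]
        norm_num
    have hk0 : 0 ≤ k d := indicator_nonneg _
    rw [hs, hk, vertexCharge, ← hce]
    linarith
  have := Finset.sum_le_sum hdiff
  rw [Finset.sum_sub_distrib] at this
  linarith

/-- The number of darts on the face traced from `d`. -/
noncomputable def faceLength (σ : Equiv.Perm G.Dart) (d : G.Dart) : ℕ :=
  {x | SameCycle.setoid (σ * G.dartSymm) d x}.ncard

/-- A face closing after one step would need a loop, and one closing after two steps a vertex of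
degree 1. -/
theorem faceLength_ge [Finite V] (h : IsRotationOn σ S) (hS : NoLightDart S) {d : G.Dart}
    (hd : d ∈ S) : 3 ≤ faceLength σ d ∧ (¬ IsTriangular σ d → 4 ≤ faceLength σ d) ∧
      (¬ IsTriangular σ d → ¬ IsQuadrangular σ d → 5 ≤ faceLength σ d) := by
  classical
  have : Fintype V := Fintype.ofFinite V
  let φ := σ * G.dartSymm
  have hφ : ∀ x : G.Dart, φ x = σ x.symm := fun _ => rfl
  have ne1 : φ d ≠ d := by
    intro e
    have := congrArg (fun x : G.Dart => x.fst) e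
    exact d.snd_ne_fst ((h.fst_face d).symm.trans this)
  have ne2 : φ (φ d) ≠ d := by
    intro e
    have h1 : (φ d).snd = d.fst := by
      have := congrArg (fun x : G.Dart => x.fst) e
      exact (h.fst_face (φ d)).symm.trans this
    have h2 : φ d = d.symm := Dart.ext_fst_snd (h.fst_face d) h1
    have h3 := hS.three_le _ (h.symm_mem d hd)
    exact h.apply_ne (h.symm_mem d hd) (by omega) h2
  have hmem : ∀ n : ℕ, (φ ^ n) d ∈ {x | SameCycle.setoid φ d x} := fun n => ⟨n, rfl⟩
  have key : ∀ n : ℕ, (∀ i < n, 0 < i → (φ ^ i) d ≠ d) → n ≤ faceLength σ d := by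
    intro n hn
    have hinj : Set.InjOn (fun i => (φ ^ i) d) (Finset.range n) := by
      have aux : ∀ i < n, ∀ j < n, i ≤ j → (φ ^ i) d = (φ ^ j) d → i = j := by
        intro i _ j hj hij he
        obtain ⟨m, rfl⟩ := Nat.exists_eq_add_of_le hij
        by_contra hne
        refine hn m (by omega) (by omega) ((φ ^ i).injective ?_)
        rw [← Equiv.Perm.mul_apply, ← pow_add]
        exact he.symm
      intro i hi j hj he
      rw [Finset.mem_coe, Finset.mem_range] at hi hj
      rcases le_total i j with hij | hij
      · exact aux i hi j hj hij he
      · exact (aux j hj i hi hij he.symm).symm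
    rw [← Finset.card_range n, ← Finset.card_image_of_injOn hinj, ← Set.ncard_coe_finset]
    refine Set.ncard_le_ncard (fun x hx => ?_) (Set.toFinite _)
    obtain ⟨i, -, rfl⟩ := Finset.mem_image.1 (Finset.mem_coe.1 hx)
    exact hmem i
  refine ⟨key 3 ?_, fun ht => key 4 ?_, fun ht hq => key 5 ?_⟩ <;> intro i hi hi0 <;>
    interval_cases i
  all_goals first | exact ne1 | exact ne2 | exact ht | exact hq

/-- Discharging: a subgraph without light edges has nonpositive total curvature. -/
theorem sum_curvature_le [Finite V] (h : IsRotationOn σ S) (hnet : ¬ G.HasNet 5)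
    (hS : NoLightDart S) : ∑ d ∈ S, ((({x | SameCycle.setoid σ d x}.ncard : ℚ))⁻¹
      + ((faceLength σ d : ℕ) : ℚ)⁻¹ - 1 / 2) ≤ 0 := by
  -- Minus four times the curvature is (1 - 4/v) + (1 - 4/l), the dart's share of the initial
  -- charge. The transfers between the ends or sides of an edge are antisymmetric under reversal and
  -- cancel over `S`.
  have hpt : ∀ d ∈ S, 4 * ((({x | SameCycle.setoid σ d x}.ncard : ℚ))⁻¹
      + ((faceLength σ d : ℕ) : ℚ)⁻¹ - 1 / 2) ≤ -(vertexCharge σ S d + faceCharge σ S d)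
      + 1 / 3 * (indicator (dartDegree S d.fst = 3) - indicator (dartDegree S d.snd = 3))
      + 1 / 5 * (indicator (IsWheelCentre σ S d.fst) - indicator (IsWheelCentre σ S d.snd))
      + 1 / 5 * (indicator (IsTriangular σ d ∧ ¬ IsTriangular σ d.symm)
        - indicator (IsTriangular σ d.symm ∧ ¬ IsTriangular σ d)) := by
    intro d hd
    have h3 := hS.three_le d hd
    have hv : (({x | SameCycle.setoid σ d x}.ncard : ℚ))⁻¹ ≤ 1 / dartDegree S d.fst := by
      rw [← one_div]
      have : (0 : ℚ) < dartDegree S d.fst := by exact_mod_cast (by omega)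
      gcongr
      exact h.dartDegree_le_ncard hd
    have hv4 : (4 : ℚ) / dartDegree S d.fst = 4 * (1 / dartDegree S d.fst) := by ring
    have inv_le : ∀ n : ℕ, 0 < n → n ≤ faceLength σ d →
        ((faceLength σ d : ℕ) : ℚ)⁻¹ ≤ 1 / n := by
      intro n hn hle
      rw [← one_div]
      have : (0 : ℚ) < n := by exact_mod_cast hn
      gcongr
    obtain ⟨l3, l4, l5⟩ := h.faceLength_ge hS hd
    have hf : 4 * ((faceLength σ d : ℕ) : ℚ)⁻¹ ≤ 4 / 5
        + 1 / 5 * indicator (IsQuadrangular σ d ∧ ¬ IsTriangular σ d)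
        + 8 / 15 * indicator (IsTriangular σ d) := by
      by_cases ht : IsTriangular σ d
      · rw [indicator_of_not (p := _ ∧ ¬ _) (fun h => h.2 ht), indicator_of ht]
        have := inv_le 3 (by norm_num) l3
        norm_num at this ⊢
        linarith
      · by_cases hq : IsQuadrangular σ d
        · rw [indicator_of_not ht, indicator_of ⟨hq, ht⟩]
          have := inv_le 4 (by norm_num) (l4 ht)
          norm_num at this ⊢
          linarith
        · rw [indicator_of_not ht, indicator_of_not (fun h : _ ∧ _ => hq h.1)]
          have := inv_le 5 (by norm_num) (l5 ht hq)
          norm_num at this ⊢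
          linarith
    unfold vertexCharge faceCharge
    rw [hv4]
    linarith
  have hsum := Finset.sum_le_sum hpt
  have s1 := h.sum_symm fun d => indicator (dartDegree S d.fst = 3)
  have s2 := h.sum_symm fun d => indicator (IsWheelCentre σ S d.fst)
  have s3 := h.sum_symm fun d => indicator (IsTriangular σ d ∧ ¬ IsTriangular σ d.symm)
  have hv := h.sum_vertexCharge_nonneg hnet hS
  have hf := h.sum_faceCharge_nonneg hnet hS
  simp only [Dart.symm_symm] at s3
  change ∑ d ∈ S, indicator (dartDegree S d.snd = 3) = _ at s1
  change ∑ d ∈ S, indicator (IsWheelCentre σ S d.snd) = _ at s2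
  simp only [Finset.sum_add_distrib, Finset.sum_sub_distrib, Finset.sum_neg_distrib,
    ← Finset.mul_sum] at hsum ⊢
  linarith

end IsRotationOn

/-! ### Euler's formula for subgraphs and the light edge -/

namespace IsRotationOn

variable {σ : Equiv.Perm G.Dart} {S : Finset G.Dart}

open Classical in
-- Each deleted edge, with its two darts, is an orbit of its own, and `S` contains at least one
-- further orbit.
theorem card_notMem_add_two_le [Fintype V] (h : IsRotationOn σ S) (hne : S.Nonempty) :
    (Sᶜ).card + 2 ≤
      2 * Nat.card (Quotient (SameCycle.setoid σ ⊔ SameCycle.setoid G.dartSymm)) := by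
  let g : G.Dart → Option (Sym2 V) := fun d => if d ∈ S then none else some d.edge
  have hle : SameCycle.setoid σ ⊔ SameCycle.setoid G.dartSymm ≤ Setoid.ker g := by
    refine sup_le (sameCycle_setoid_le fun d => ?_) (sameCycle_setoid_le fun d => ?_)
    · change g d = g (σ d)
      by_cases hd : d ∈ S
      · simp only [g, if_pos hd, if_pos (h.apply_mem_iff.2 hd)]
      · rw [h.apply_of_notMem d hd]
    · change g d = g d.symm
      simp only [g, h.symm_mem_iff, d.edge_symm]
  have hcard := Setoid.card_quotient_le hle
  have hrange : ((Sᶜ).image Dart.edge).card + 1 ≤ Nat.card (Quotient (Setoid.ker g)) := by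
    rw [Nat.card_congr (Setoid.quotientKerEquivRange g), ← Finset.card_map Function.Embedding.some,
      ← Finset.card_insert_of_notMem (a := none) (by simp), ← Set.ncard_coe_finset]
    refine Set.ncard_le_ncard (fun x hx => ?_) (Set.toFinite _)
    rw [Finset.mem_coe, Finset.mem_insert, Finset.mem_map] at hx
    rcases hx with rfl | ⟨e, he, rfl⟩
    · obtain ⟨d, hd⟩ := hne
      exact ⟨d, if_pos hd⟩
    · obtain ⟨d, hd, rfl⟩ := Finset.mem_image.1 he
      exact ⟨d, if_neg (Finset.mem_compl.1 hd)⟩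
  have hfib : (Sᶜ).card ≤ 2 * ((Sᶜ).image Dart.edge).card := by
    refine Finset.card_le_mul_card_image _ 2 fun e he => ?_
    obtain ⟨d, -, rfl⟩ := Finset.mem_image.1 he
    refine le_trans (Finset.card_le_card fun x hx => ?_) (Finset.card_le_two (a := d) (b := d.symm))
    simpa using (dart_edge_eq_iff x d).1 (Finset.mem_filter.1 hx).2
  omega

/-- A nonempty plane subgraph without 5-nets has a light edge. -/
theorem not_noLightDart [Finite V] (h : IsRotationOn σ S) (hE : σ.EulerBound G.dartSymm)
    (hne : S.Nonempty) (hnet : ¬ G.HasNet 5) : ¬ NoLightDart S := by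
  classical
  intro hS
  have : Fintype V := Fintype.ofFinite V
  have hsum := h.sum_curvature_le hnet hS
  have hv := Setoid.sum_inv_ncard (SameCycle.setoid σ)
  have hf := Setoid.sum_inv_ncard (SameCycle.setoid (σ * G.dartSymm))
  -- A deleted dart is fixed by `σ` and lies on the face formed by it and its reversal, so it
  -- contributes at most 1 + 1/2 - 1/2.
  have hcompl : ∑ d ∈ Sᶜ, ((({x | SameCycle.setoid σ d x}.ncard : ℚ))⁻¹
      + ((faceLength σ d : ℕ) : ℚ)⁻¹ - 1 / 2) ≤ ∑ d ∈ Sᶜ, (1 : ℚ) := by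
    refine Finset.sum_le_sum fun d hd => ?_
    have hd' : d.symm ∉ S := fun hs => Finset.mem_compl.1 hd (h.symm_mem_iff.1 hs)
    have h1 : (({x | SameCycle.setoid σ d x}.ncard : ℚ))⁻¹ ≤ 1 := Nat.cast_inv_le_one _
    have h2 : 2 ≤ faceLength σ d := by
      rw [← Finset.card_pair d.symm_ne, ← Set.ncard_coe_finset]
      refine Set.ncard_le_ncard (fun x hx => ?_) (Set.toFinite _)
      rw [Finset.mem_coe, Finset.mem_insert, Finset.mem_singleton] at hx
      rcases hx with rfl | rfl
      · exact ⟨1, (zpow_one (σ * G.dartSymm)).symm ▸ h.apply_of_notMem _ hd'⟩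
      · exact SameCycle.refl _ _
    have h3 : ((faceLength σ d : ℕ) : ℚ)⁻¹ ≤ 2⁻¹ := by
      gcongr; exact_mod_cast h2
    linarith
  have hall := Finset.sum_add_sum_compl S fun d : G.Dart =>
    (({x | SameCycle.setoid σ d x}.ncard : ℚ))⁻¹ + ((faceLength σ d : ℕ) : ℚ)⁻¹ - 1 / 2
  have htotal : ∑ d : G.Dart, ((({x | SameCycle.setoid σ d x}.ncard : ℚ))⁻¹
      + ((faceLength σ d : ℕ) : ℚ)⁻¹ - 1 / 2) = Nat.card (Quotient (SameCycle.setoid σ))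
      + Nat.card (Quotient (SameCycle.setoid (σ * G.dartSymm))) - ∑ _d : G.Dart, 1 / 2 := by
    rw [Finset.sum_sub_distrib, Finset.sum_add_distrib, ← hv, ← hf]
    rfl
  rw [htotal] at hall
  simp only [Finset.sum_const, nsmul_eq_mul, mul_one, Finset.card_univ] at hall hcompl
  have hc := h.card_notMem_add_two_le hne
  unfold EulerBound numCycles at hE
  rw [Nat.card_eq_fintype_card (α := G.Dart)] at hE
  have hE' : (Fintype.card G.Dart : ℚ) +
      4 * Nat.card (Quotient (SameCycle.setoid σ ⊔ SameCycle.setoid G.dartSymm)) ≤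
      2 * Nat.card (Quotient (SameCycle.setoid σ)) +
      2 * Nat.card (Quotient (SameCycle.setoid (σ * G.dartSymm))) := by exact_mod_cast hE
  have hc' : ((Sᶜ).card : ℚ) + 2 ≤
      2 * Nat.card (Quotient (SameCycle.setoid σ ⊔ SameCycle.setoid G.dartSymm)) := by
    exact_mod_cast hc
  -- With C orbits the total is at least 2C, while `S` contributes at most 0 and the deleted darts
  -- at most 2C - 2.
  linarith

open Classical in
/-- Deleting an edge from a plane subgraph. -/
theorem exists_erase [Finite V] (h : IsRotationOn σ S) (hE : σ.EulerBound G.dartSymm)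
    (a : G.Dart) : ∃ σ' : Equiv.Perm G.Dart,
      IsRotationOn σ' ((S.erase a).erase a.symm) ∧ σ'.EulerBound G.dartSymm := by
  have : Fintype V := Fintype.ofFinite V
  -- The two darts of the edge are detached from their cycles one after the other.
  let σ₁ := Equiv.swap a (σ a) * σ
  let σ₂ := Equiv.swap a.symm (σ₁ a.symm) * σ₁
  have fix : ∀ (π : Equiv.Perm G.Dart) (b d : G.Dart), d = b ∨ π d = d →
      (Equiv.swap b (π b) * π) d = d := by
    intro π b d hd
    rw [Equiv.Perm.mul_apply]
    by_cases hdb : d = b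
    · rw [hdb, Equiv.swap_apply_right]
    · have hπ := hd.resolve_left hdb
      rw [hπ, Equiv.swap_apply_of_ne_of_ne hdb]
      exact fun e => hdb (π.injective (hπ.trans e))
  have fst : ∀ (π : Equiv.Perm G.Dart) (b : G.Dart), (∀ d, (π d).fst = d.fst) →
      ∀ d, ((Equiv.swap b (π b) * π) d).fst = d.fst := by
    intro π b hπ d
    rw [Equiv.Perm.mul_apply, ← hπ d]
    exact ((Setoid.ker fun x : G.Dart => x.fst).rel_swap_apply
      (x := b) (y := π b) (hπ b).symm (π d)).symm
  refine ⟨σ₂, ⟨fun d hd => ?_, fun d hd => ?_, fst σ₁ _ (fst σ a h.fst_apply),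
    fun d hd d' hd' hdd => ?_⟩, (hE.swap_mul a).swap_mul a.symm⟩
  · simp only [Finset.mem_erase] at hd ⊢
    refine ⟨fun e => hd.2.1 (Dart.symm_involutive.injective e), fun e => hd.1 ?_,
      h.symm_mem d hd.2.2⟩
    rw [← e, d.symm_symm]
  · refine fix σ₁ a.symm d ?_
    by_cases h1 : d = a.symm
    · exact Or.inl h1
    · refine Or.inr (fix σ a d ?_)
      by_cases h2 : d = a
      · exact Or.inl h2
      · exact Or.inr (h.apply_of_notMem d fun hS =>
          hd (Finset.mem_erase.2 ⟨h1, Finset.mem_erase.2 ⟨h2, hS⟩⟩))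
  · simp only [Finset.mem_erase] at hd hd'
    exact ((h.sameCycle d hd.2.2 d' hd'.2.2 hdd).swap_mul hd.2.1 hd'.2.1).swap_mul hd.1 hd'.1

end IsRotationOn

/-! ### From spherical rotation systems to Euler's inequality -/

theorem RotationSystem.isRotationOn_univ [Fintype G.Dart] (R : G.RotationSystem) :
    IsRotationOn R.next (Finset.univ : Finset G.Dart) where
  symm_mem _ _ := Finset.mem_univ _
  apply_of_notMem d hd := absurd (Finset.mem_univ d) hd
  fst_apply := R.fst_next
  sameCycle d _ d' _ h := R.sameCycle d d' h

/-- Orbits of darts and isolated vertices lie in different connected components. -/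
theorem RotationSystem.card_orbits_add_card_isolated_le [Finite V] (R : G.RotationSystem) :
    Nat.card (Quotient (SameCycle.setoid R.next ⊔ SameCycle.setoid G.dartSymm))
      + Nat.card {v : V // ∀ w, ¬ G.Adj v w} ≤ Nat.card G.ConnectedComponent := by
  classical
  have : Fintype V := Fintype.ofFinite V
  set C := SameCycle.setoid R.next ⊔ SameCycle.setoid G.dartSymm
  have hnext : ∀ d d' : G.Dart, d.fst = d'.fst → C d d' := fun d d' hdd =>
    (le_sup_left : SameCycle.setoid R.next ≤ C) (R.sameCycle d d' hdd)
  have hsymm : ∀ d : G.Dart, C d d.symm := fun d =>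
    (le_sup_right : SameCycle.setoid G.dartSymm ≤ C) (sameCycle_apply_self G.dartSymm d)
  have hle : C ≤ Setoid.ker fun d : G.Dart => G.connectedComponentMk d.fst := by
    refine sup_le (sameCycle_setoid_le fun d => ?_) (sameCycle_setoid_le fun d => ?_)
    · change G.connectedComponentMk d.fst = G.connectedComponentMk (R.next d).fst
      rw [R.fst_next]
    · exact ConnectedComponent.sound d.adj.reachable
  have hwalk : ∀ {u w : V} (_ : G.Walk u w) (d d' : G.Dart), d.fst = u → d'.fst = w → C d d' := by
    intro u w p
    induction p with
    | nil => exact fun d d' hd hd' => hnext d d' (hd.trans hd'.symm)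
    | @cons u x w hux q ih =>
      intro d d' hd hd'
      let y : G.Dart := ⟨(u, x), hux⟩
      exact C.trans (hnext d y hd) (C.trans (hsymm y) (ih y.symm d' rfl hd'))
  let f : Quotient C ⊕ {v : V // ∀ w, ¬ G.Adj v w} → G.ConnectedComponent :=
    Sum.elim (Quotient.lift (fun d : G.Dart => G.connectedComponentMk d.fst) fun _ _ h => hle h)
      fun v => G.connectedComponentMk v
  have hiso : ∀ {v w : V}, (∀ x, ¬ G.Adj v x) → G.connectedComponentMk v =
      G.connectedComponentMk w → v = w := by
    intro v w hv he
    obtain ⟨p⟩ := ConnectedComponent.exact he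
    cases p with
    | nil => rfl
    | cons h _ => exact absurd h (hv _)
  rw [← Nat.card_sum]
  refine Nat.card_le_card_of_injective f ?_
  rintro (q | v) (q' | v') he
  · obtain ⟨d, rfl⟩ := Quotient.exists_rep q
    obtain ⟨d', rfl⟩ := Quotient.exists_rep q'
    obtain ⟨p⟩ := ConnectedComponent.exact he
    exact congrArg Sum.inl (Quotient.sound (hwalk p d d' rfl rfl))
  · obtain ⟨d, rfl⟩ := Quotient.exists_rep q
    have : v'.1 = d.fst := hiso v'.2 he.symm
    exact absurd d.adj (this ▸ v'.2 d.snd)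
  · obtain ⟨d, rfl⟩ := Quotient.exists_rep q'
    have : v.1 = d.fst := hiso v.2 he
    exact absurd d.adj (this ▸ v.2 d.snd)
  · exact congrArg Sum.inr (Subtype.ext (hiso v.2 he))

theorem RotationSystem.card_le_numCycles_add [Finite V] (R : G.RotationSystem) :
    Nat.card V ≤ R.next.numCycles + Nat.card {v : V // ∀ w, ¬ G.Adj v w} := by
  classical
  have : Fintype V := Fintype.ofFinite V
  unfold numCycles
  rw [← Nat.card_sum]
  let f : V → Quotient (SameCycle.setoid R.next) ⊕ {v : V // ∀ w, ¬ G.Adj v w} := fun v =>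
    if h : ∃ w, G.Adj v w then Sum.inl (Quotient.mk _ ⟨(v, h.choose), h.choose_spec⟩)
    else Sum.inr ⟨v, not_exists.1 h⟩
  refine Nat.card_le_card_of_injective f fun v w hvw => ?_
  have hle : SameCycle.setoid R.next ≤ Setoid.ker fun d : G.Dart => d.fst :=
    sameCycle_setoid_le fun d => (R.fst_next d).symm
  by_cases hv : ∃ x, G.Adj v x <;> by_cases hw : ∃ x, G.Adj w x
  · simp only [f, dif_pos hv, dif_pos hw] at hvw
    exact hle (Quotient.exact (Sum.inl.inj hvw))
  · simp [f, dif_pos hv, dif_neg hw] at hvw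
  · simp [f, dif_neg hv, dif_pos hw] at hvw
  · simp only [f, dif_neg hv, dif_neg hw] at hvw
    exact congrArg Subtype.val (Sum.inr.inj hvw)

/-- Isolated vertices carry no darts. Each counts once as a vertex, as a face and as a component,
which cancels since 1 + 1 = 2 · 1. -/
theorem RotationSystem.IsSpherical.eulerBound [Finite V] {R : G.RotationSystem}
    (hR : R.IsSpherical) : R.next.EulerBound G.dartSymm := by
  classical
  have : Fintype V := Fintype.ofFinite V
  have h1 := R.card_orbits_add_card_isolated_le
  have h2 := R.card_le_numCycles_add
  have h3 : Nat.card G.Dart = 2 * Nat.card G.edgeSet := by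
    rw [Nat.card_eq_fintype_card, G.dart_card_eq_twice_card_edges, edgeFinset_card,
      Nat.card_eq_fintype_card]
  have h4 : Nat.card R.Face = (R.next * G.dartSymm).numCycles
      + Nat.card {v : V // ∀ w, ¬ G.Adj v w} := Nat.card_sum
  unfold RotationSystem.IsSpherical at hR
  unfold EulerBound
  omega

/-! ### Greedy colouring -/

open Classical in
/-- A group list coloring of part of a graph extends to a further vertex whose list is larger than
the number of its coloured neighbours. -/
theorem exists_extend_coloring {W : Type*} [DecidableEq W] {H : SimpleGraph W} {A : Type u} [AddCommGroup A]
    (D : H.Orientation) (L : W → Finset A) (f : H.edgeSet → A) (P : Finset W) (x : W)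
    (hL : (P.filter fun y => H.Adj x y).card < (L x).card) (c : W → A)
    (hcL : ∀ y ∈ P, c y ∈ L y)
    (hc : ∀ e, (D.dart e).fst ∈ P → (D.dart e).snd ∈ P →
      c (D.dart e).fst - c (D.dart e).snd ≠ f e) :
    ∃ c' : W → A, (∀ y ∈ insert x P, c' y ∈ L y) ∧
      ∀ e, (D.dart e).fst ∈ insert x P → (D.dart e).snd ∈ insert x P →
        c' (D.dart e).fst - c' (D.dart e).snd ≠ f e := by
  -- For a neighbour `y` of `x` in `P`, `bad y` is the one colour that `y` forbids at `x`; the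
  -- orientation decides the sign.
  let bad : W → A := fun y =>
    if h : H.Adj x y then
      if (D.dart ⟨s(x, y), h⟩).fst = x then f ⟨s(x, y), h⟩ + c y else c y - f ⟨s(x, y), h⟩
    else 0
  obtain ⟨α, hα, hbad⟩ := Finset.exists_mem_notMem_of_card_lt_card
    ((Finset.card_image_le (s := P.filter fun y => H.Adj x y) (f := bad)).trans_lt hL)
  have hbad' : ∀ y ∈ P, H.Adj x y → bad y ≠ α := fun y hy hxy e =>
    hbad (Finset.mem_image.2 ⟨y, Finset.mem_filter.2 ⟨hy, hxy⟩, e⟩)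
  refine ⟨Function.update c x α, fun y hy => ?_, fun e h1 h2 heq => ?_⟩
  · by_cases hyx : y = x
    · rw [hyx, Function.update_self]; exact hα
    · rw [Function.update_of_ne hyx]
      exact hcL y ((Finset.mem_insert.1 hy).resolve_left hyx)
  · have hne := (D.dart e).fst_ne_snd
    have hadj := (D.dart e).adj
    have hedge : s((D.dart e).fst, (D.dart e).snd) = e.1 := D.edge_dart e
    by_cases hf : (D.dart e).fst = x
    · have hs : (D.dart e).snd ≠ x := fun h => hne (hf.trans h.symm)
      have hs2 := (Finset.mem_insert.1 h2).resolve_left hs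
      rw [hf, Function.update_self, Function.update_of_ne hs] at heq
      rw [hf] at hadj hedge
      refine hbad' _ hs2 hadj ?_
      have he : (⟨s(x, (D.dart e).snd), hadj⟩ : H.edgeSet) = e := Subtype.ext hedge
      simp only [bad, dif_pos hadj, he, if_pos hf]
      rw [← heq, sub_add_cancel]
    · have hf2 := (Finset.mem_insert.1 h1).resolve_left hf
      by_cases hs : (D.dart e).snd = x
      · rw [hs, Function.update_self, Function.update_of_ne hf] at heq
        rw [hs] at hadj hedge
        refine hbad' _ hf2 hadj.symm ?_
        have he : (⟨s(x, (D.dart e).fst), hadj.symm⟩ : H.edgeSet) = e :=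
          Subtype.ext (Sym2.eq_swap.trans hedge)
        simp only [bad, dif_pos hadj.symm, he, if_neg hf]
        rw [← heq, sub_sub_cancel]
      · rw [Function.update_of_ne hf, Function.update_of_ne hs] at heq
        exact hc e hf2 ((Finset.mem_insert.1 h2).resolve_left hs) heq

open Classical in
/-- The edges of the subgraph whose set of darts is `S`. -/
noncomputable def edgesOfDarts (S : Finset G.Dart) : Finset G.edgeSet :=
  S.image fun d => ⟨d.edge, d.edge_mem⟩

open Classical in
-- The edge of `a` meets at most d(u) - 1 others at one end and d(v) - 1 at the other.
theorem card_lineGraph_neighbours_lt {S : Finset G.Dart} {a : G.Dart} (ha : a ∈ S)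
    (ha' : a.symm ∈ S) {k : ℕ} (hk : dartDegree S a.fst + dartDegree S a.snd ≤ k + 1)
    (hsymm : ∀ d ∈ S, d.symm ∈ S) :
    ((edgesOfDarts ((S.erase a).erase a.symm)).filter fun y =>
      G.lineGraph.Adj ⟨a.edge, a.edge_mem⟩ y).card < k := by
  have hsub : ((edgesOfDarts ((S.erase a).erase a.symm)).filter fun y =>
      G.lineGraph.Adj ⟨a.edge, a.edge_mem⟩ y) ⊆
      (((S.filter fun d => d.fst = a.fst).erase a) ∪
        ((S.filter fun d => d.fst = a.snd).erase a.symm)).image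
          fun d => (⟨d.edge, d.edge_mem⟩ : G.edgeSet) := by
    intro y hy
    obtain ⟨hy, hadj⟩ := Finset.mem_filter.1 hy
    obtain ⟨d, hd, rfl⟩ := Finset.mem_image.1 hy
    simp only [Finset.mem_erase] at hd
    obtain ⟨hd1, hd2, hdS⟩ := hd
    have hs1 : d.symm ≠ a := fun e => hd1 (e ▸ d.symm_symm.symm)
    have hs2 : d.symm ≠ a.symm := fun e => hd2 (Dart.symm_involutive.injective e)
    obtain ⟨-, v, hv1, hv2⟩ := hadj
    have hv1 : v = a.fst ∨ v = a.snd := Sym2.mem_iff.1 hv1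
    have hv2 : v = d.fst ∨ v = d.snd := Sym2.mem_iff.1 hv2
    rw [Finset.mem_image]
    obtain ⟨x, hxS, hxa, hxa', hxv, hxe⟩ : ∃ x ∈ S, x ≠ a ∧ x ≠ a.symm ∧ x.fst = v ∧
        x.edge = d.edge := by
      rcases hv2 with rfl | rfl
      · exact ⟨d, hdS, hd2, hd1, rfl, rfl⟩
      · exact ⟨d.symm, hsymm d hdS, hs1, hs2, rfl, d.edge_symm⟩
    refine ⟨x, ?_, Subtype.ext hxe⟩
    rw [Finset.mem_union, Finset.mem_erase, Finset.mem_erase, Finset.mem_filter, Finset.mem_filter,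
      hxv]
    tauto
  have h1 : ((S.filter fun d => d.fst = a.fst).erase a).card + 1 = dartDegree S a.fst :=
    Finset.card_erase_add_one (Finset.mem_filter.2 ⟨ha, rfl⟩)
  have h2 : ((S.filter fun d => d.fst = a.snd).erase a.symm).card + 1 = dartDegree S a.snd :=
    Finset.card_erase_add_one (Finset.mem_filter.2 ⟨ha', rfl⟩)
  have h3 := (Finset.card_le_card hsub).trans (Finset.card_image_le.trans
    (Finset.card_union_le _ _))
  omega

/-- If every nonempty plane subgraph has an edge meeting fewer than `k` others, the line graph is
`k`-group choosable. -/
theorem IsPlanar.groupChoosable_lineGraph [Finite V] (hplanar : G.IsPlanar) {k : ℕ}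
    (hlight : ∀ (σ : Equiv.Perm G.Dart) (S : Finset G.Dart), IsRotationOn σ S →
      σ.EulerBound G.dartSymm → S.Nonempty →
      ∃ a ∈ S, dartDegree S a.fst + dartDegree S a.snd ≤ k + 1) :
    GroupChoosable.{u} G.lineGraph k := by
  classical
  intro A _ _ L hL D f
  obtain ⟨R, hR⟩ := hplanar
  have : Fintype V := Fintype.ofFinite V
  -- Induction on the number of darts: delete a light edge, colour the rest, then colour that edge
  -- last.
  have main : ∀ (n : ℕ) (S : Finset G.Dart), S.card = n → ∀ σ : Equiv.Perm G.Dart,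
      IsRotationOn σ S → σ.EulerBound G.dartSymm →
      ∃ c : G.edgeSet → A, (∀ y ∈ edgesOfDarts S, c y ∈ L y) ∧
        ∀ e, (D.dart e).fst ∈ edgesOfDarts S → (D.dart e).snd ∈ edgesOfDarts S →
          c (D.dart e).fst - c (D.dart e).snd ≠ f e := by
    intro n
    induction n using Nat.strong_induction_on with
    | _ n ih =>
      rintro S rfl σ h hE
      rcases S.eq_empty_or_nonempty with rfl | hne
      · exact ⟨0, by simp [edgesOfDarts], by simp [edgesOfDarts]⟩
      · obtain ⟨a, ha, hk⟩ := hlight σ S h hE hne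
        have ha' := h.symm_mem a ha
        obtain ⟨σ', h', hE'⟩ := h.exists_erase hE a
        have hlt : ((S.erase a).erase a.symm).card < S.card :=
          Finset.card_le_card (Finset.erase_subset _ _) |>.trans_lt (Finset.card_erase_lt_of_mem ha)
        obtain ⟨c, hc1, hc2⟩ := ih _ hlt _ rfl σ' h' hE'
        have hins : edgesOfDarts S =
            insert ⟨a.edge, a.edge_mem⟩ (edgesOfDarts ((S.erase a).erase a.symm)) := by
          conv_lhs => rw [← Finset.insert_erase ha,
            ← Finset.insert_erase (Finset.mem_erase.2 ⟨a.symm_ne, ha'⟩)]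
          simp [edgesOfDarts, Finset.image_insert]
        rw [hins]
        refine exists_extend_coloring D L f _ _ ?_ c hc1 hc2
        rw [hL]
        exact card_lineGraph_neighbours_lt ha ha' hk h.symm_mem
  obtain ⟨c, hc1, hc2⟩ := main _ Finset.univ rfl R.next R.isRotationOn_univ hR.eulerBound
  have huniv : ∀ y : G.edgeSet, y ∈ edgesOfDarts (Finset.univ : Finset G.Dart) := by
    rintro ⟨⟨x, y⟩, hxy⟩
    exact Finset.mem_image.2 ⟨⟨(x, y), hxy⟩, Finset.mem_univ _, rfl⟩
  exact ⟨c, fun y => hc1 y (huniv y), fun e => hc2 e (huniv _) (huniv _)⟩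

theorem IsPlanar.groupChoiceIndex_le [Finite V] (hplanar : G.IsPlanar) (hnet : ¬ G.HasNet 5)
    {k : ℕ} (hdeg : ∀ S : Finset G.Dart,
      (∀ d ∈ S, k + 2 ≤ dartDegree S d.fst + dartDegree S d.snd) → NoLightDart S) :
    groupChoiceIndex.{u} G ≤ k := by
  refine iInf₂_le k (hplanar.groupChoosable_lineGraph fun σ S h hE hne => ?_)
  by_contra hno
  push Not at hno
  exact h.not_noLightDart hE hne hnet (hdeg S fun d hd => hno d hd)

end SimpleGraph

end

theorem mainTheorem10 {V : Type v} [Fintype V] (G : SimpleGraph V) [DecidableRel G.Adj]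
    (hplanar : G.IsPlanar) (hnet : ¬ G.HasNet 5) :
    (6 ≤ G.maxDegree →
      SimpleGraph.groupChoiceIndex.{u} G ≤ ((max 8 (G.maxDegree + 1) : ℕ) : ℕ∞)) ∧
    (G.maxDegree = 5 → (¬ G.HasNet 4 ∨ ¬ G.HasNet 6) →
      SimpleGraph.groupChoiceIndex.{u} G ≤ 7) := by
  -- Without light edges, degree sums are at least k + 2. For k = max 8 (Δ + 1) this is at least 10
  -- and Δ + 3, so degrees are at least 3, and neighbours of 3- and 4-vertices have degree at least
  -- 7 and 6. For k = 7 and Δ = 5 it is 9, so degrees are 4 or 5 and no two 4-vertices are adjacent.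
  have key : ∀ k : ℕ, (k = 7 ∧ G.maxDegree = 5 ∨ k = max 8 (G.maxDegree + 1)) →
      SimpleGraph.groupChoiceIndex.{u} G ≤ k := by
    intro k hk
    refine hplanar.groupChoiceIndex_le hnet fun S hS => ⟨?_, ?_, ?_⟩ <;> intro d hd <;>
      have h1 := hS d hd <;> have h2 := SimpleGraph.dartDegree_le S d.fst <;>
      have h3 := SimpleGraph.dartDegree_le S d.snd <;> omega
  exact ⟨fun _ => key _ (Or.inr rfl), fun h5 _ => key 7 (Or.inl ⟨rfl, h5⟩)⟩
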